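/- Let $\Omega\subset\mathbb R^2$ be a bounded polygonal domain, i.e. a nonempty connected open set with $\operatorname{int}\overline\Omega=\Omega$ whose closure is a finite union of nondegenerate closed triangles, and let $u(x_1,x_2)=x_1^2+x_2^2$. For a conforming triangulation $\mathcal T$ of $\overline\Omega$ into closed triangles (elements), let $h$ be the maximal diameter of its elements and let $X_h$ be the space of continuous functions on $\overline\Omega$ that are affine on each element. Write $|K|$ for the area of $K$ and $|v|_{H^1(S)}=\big(\int_S|\nabla v|^2\,dx\big)^{1/2}$. A (straight) band in $\mathcal T$ consists of elements $K_0,\dots,K_N$ and $\tilde K_1,\dots,\tilde K_N$ of $\mathcal T$, $N\ge 1$, of the following form: there are points $p_0,\dots,p_{N+1}$, consecutively ordered on a straight line, and points $q_0,\dots,q_N$ strictly on one side of that line, such that $K_i$ is the triangle $p_i\,p_{i+1}\,q_i$ and its maximum angle $\alpha_i$ is at $q_i$ ($0\le i\le N$), and $\tilde K_i$ is the triangle $p_i\,q_{i-1}\,q_i$ and its maximum angle $\tilde\alpha_i$ is at $p_i$ ($1\le i\le N$). Its edge $\Gamma$ is the segment $p_0p_{N+1}$, and $L=|p_{N+1}-p_0|$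 is its length. Two bands are disjoint if they have no element in common. **Theorem.** Let $\alpha\in[0,1]$ and $C(u)\in\mathbb R$. There are constants $C_L,C_1>0$, depending only on $\Omega$, $\alpha$ and $C(u)$, and for all constants $C_K,C_\alpha$ there is a constant $C_2>0$, depending only on $\Omega,\alpha,C(u),C_K,C_\alpha$, such that the following holds for every conforming triangulation $\mathcal T$ of $\overline\Omega$ and every $U\in X_h$ satisfying $$|u-U|_{H^1(\Omega)}\le C(u)\,h^\alpha .$$ Let $\mathcal B_1,\dots,\mathcal B_{N_{\mathcal B}}$ be pairwise disjoint bands in $\mathcal T$, where $\mathcal B_b$ consists of the elements $K_0^b,\dots,K_{N_b}^b$ and $\tilde K_1^b,\dots,\tilde K_{N_b}^b$, has edge length $L_b$ and maximum angles $\alpha_i^b$, $\tilde\alpha_i^b$, such that for all $b=1,\dots,N_{\mathcal B}$ and $i=1,\dots,N_b$ $$|\tilde K_i^b|\le C_K|K_i^b|,\qquad |\tilde K_i^b|\le C_K|K_{i-1}^b|,\qquad \sin(\pi-\alpha_{i-1}^b)\le C_\alpha\sin(\pi-\tilde\alpha_i^b),$$ and $L_b\ge C_L h^{2\alpha/5}$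 for all $b$. Then, with $\mathbb B=\bigcup_{b=1}^{N_{\mathcal B}}\mathcal B_b$, there are real numbers $\mathcal A_1,\mathcal A_2$ with $$|u-U|_{H^1(\mathbb B)}\ge \mathcal A_1-\mathcal A_2,$$ $$\mathcal A_1\ge C_1\Big(\sum_{b=1}^{N_{\mathcal B}}\ \min_{i=1,\dots,N_b}\frac{1}{\sin^2(\pi-\tilde\alpha_i^b)}\ \min_{i=1,\dots,N_b}|\tilde K_i^b|\ L_b^2N_b^{-1}\Big)^{1/2},\qquad |\mathcal A_2|\le C_2h^\alpha .$$ -/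

import Mathlib

open Set MeasureTheory

noncomputable section

namespace FEMBand

/-- The Euclidean plane. -/
abbrev Plane := EuclideanSpace ℝ (Fin 2)

open Classical in
/-- The triangle with vertices `a, b, c`, encoded by its set of vertices. -/
def tri (a b c : Plane) : Finset Plane := {a, b, c}

/-- The closed triangle (as a point set) with vertex set `s`. -/
def body (s : Finset Plane) : Set Plane := convexHull ℝ (s : Set Plane)

/-- The area `|K|` of a triangle. -/
def area (s : Finset Plane) : ℝ := volume.real (body s)

/-- A bounded polygonal domain: a nonempty connected open set, without slits, whose closure is a
finite union of nondegenerate closed triangles. -/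
structure IsPolygonalDomain (Ω : Set Plane) : Prop where
  isOpen : IsOpen Ω
  isConnected : IsConnected Ω
  interior_closure : interior (closure Ω) = Ω
  polygonal : ∃ F : Finset (Finset Plane),
    (∀ s ∈ F, s.card = 3 ∧ AffineIndependent ℝ ((↑) : s → Plane)) ∧
      closure Ω = ⋃ s ∈ F, body s

/-- A conforming triangulation: a finite geometric simplicial complex (two of its simplices meet in
a common face or not at all) whose underlying space is `closure Ω`. -/
structure IsTriangulation (T : Geometry.SimplicialComplex ℝ Plane) (Ω : Set Plane) : Prop where
  finite : T.faces.Finite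
  space_eq : T.space = closure Ω

/-- The elements of a triangulation are its two-dimensional simplices. -/
def elements (T : Geometry.SimplicialComplex ℝ Plane) : Set (Finset Plane) :=
  {s ∈ T.faces | s.card = 3}

/-- `h` is the maximal diameter of the elements of `T`. -/
def IsMeshSize (T : Geometry.SimplicialComplex ℝ Plane) (h : ℝ) : Prop :=
  IsGreatest ((fun s => Metric.diam (body s)) '' elements T) h

/-- The discrete space `X_h`: continuous functions on the triangulated set which are affine on each
element. (Values outside the triangulated set are irrelevant.) -/
def X (T : Geometry.SimplicialComplex ℝ Plane) : Set (Plane → ℝ) :=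
  {U | ContinuousOn U T.space ∧
    ∀ s ∈ elements T, ∃ f : Plane →ᵃ[ℝ] ℝ, EqOn U f (body s)}

/-- The `H¹` seminorm `|f|_{H¹(S)} = (∫_S |∇f|²)^{1/2}`. It is only applied to continuous functions
which are smooth on each element of a triangulation, whose weak gradient is the almost everywhere
defined classical gradient. -/
def h1Seminorm (S : Set Plane) (f : Plane → ℝ) : ℝ :=
  Real.sqrt (∫ x in S, ‖gradient f x‖ ^ 2)

/-- The function `u(x₁, x₂) = x₁² + x₂²`. -/
def uExact (x : Plane) : ℝ := x 0 ^ 2 + x 1 ^ 2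

/-- A straight band of elements of `T`. The points `p 0, …, p (N+1)` are consecutive points of a
line (the edge `Γ` of the band is the segment from `p 0` to `p (N+1)`), the points `q 0, …, q N` lie
strictly on one side of this line (values of `p` and `q` at larger indices are irrelevant).
The band consists of the elements `K i` with vertices `p i, p (i+1), q i` for `0 ≤ i ≤ N`,
and of the elements `Kt i` with vertices `p i, q (i-1), q i` for `1 ≤ i ≤ N`.
The maximum angle of `K i` is at `q i`, so that the longest edge of `K i` lies on `Γ`,
and the maximum angle of `Kt i` is at `p i`, on `Γ`. -/
structure Band (T : Geometry.SimplicialComplex ℝ Plane) where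
  N : ℕ
  one_le_N : 1 ≤ N
  p : ℕ → Plane
  q : ℕ → Plane
  /-- the unit vector in the direction of `Γ` -/
  g : Plane
  norm_g : ‖g‖ = 1
  straight : ∀ i ≤ N, ∃ ℓ : ℝ, 0 < ℓ ∧ p (i + 1) = p i + ℓ • g
  one_side : ∃ n : Plane, inner ℝ n g = 0 ∧ ∀ i ≤ N, 0 < inner ℝ n (q i - p 0)
  K_mem : ∀ i ≤ N, tri (p i) (p (i + 1)) (q i) ∈ elements T
  Kt_mem : ∀ i ∈ Finset.Icc 1 N, tri (p i) (q (i - 1)) (q i) ∈ elements T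
  K_maxAngle : ∀ i ≤ N,
    EuclideanGeometry.angle (q i) (p i) (p (i + 1)) ≤
      EuclideanGeometry.angle (p i) (q i) (p (i + 1)) ∧
    EuclideanGeometry.angle (p i) (p (i + 1)) (q i) ≤
      EuclideanGeometry.angle (p i) (q i) (p (i + 1))
  Kt_maxAngle : ∀ i ∈ Finset.Icc 1 N,
    EuclideanGeometry.angle (p i) (q (i - 1)) (q i) ≤
      EuclideanGeometry.angle (q (i - 1)) (p i) (q i) ∧
    EuclideanGeometry.angle (q (i - 1)) (q i) (p i) ≤
      EuclideanGeometry.angle (q (i - 1)) (p i) (q i)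

namespace Band

variable {T : Geometry.SimplicialComplex ℝ Plane}

/-- The element `K_i`, `0 ≤ i ≤ N`. -/
def K (B : Band T) (i : ℕ) : Finset Plane := tri (B.p i) (B.p (i + 1)) (B.q i)

/-- The element `K̃_i`, `1 ≤ i ≤ N`. -/
def Kt (B : Band T) (i : ℕ) : Finset Plane := tri (B.p i) (B.q (i - 1)) (B.q i)

/-- The maximum angle `α_i` of `K_i`. -/
def α (B : Band T) (i : ℕ) : ℝ :=
  EuclideanGeometry.angle (B.p i) (B.q i) (B.p (i + 1))

/-- The maximum angle `α̃_i` of `K̃_i`. -/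
def αt (B : Band T) (i : ℕ) : ℝ :=
  EuclideanGeometry.angle (B.q (i - 1)) (B.p i) (B.q i)

/-- The set of all elements of the band. -/
def elems (B : Band T) : Set (Finset Plane) :=
  {s | (∃ i ≤ B.N, s = B.K i) ∨ ∃ i ∈ Finset.Icc 1 B.N, s = B.Kt i}

/-- The point set covered by the band. -/
def region (B : Band T) : Set Plane := ⋃ s ∈ B.elems, body s

/-- The length `L` of the edge `Γ`. -/
def L (B : Band T) : ℝ := dist (B.p 0) (B.p (B.N + 1))

/-- The minimum of `f i` over `i = 1, …, N`. -/
def minOver (B : Band T) (f : ℕ → ℝ) : ℝ :=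
  (Finset.Icc 1 B.N).inf' (Finset.nonempty_Icc.2 B.one_le_N) f

end Band

end FEMBand

end

/-! Along the edge of a band, `U` is piecewise affine in arc length, whereas `u` has second
derivative 2. So either the slope of `U` along the edge has total variation comparable to `L`, or
`U` is so close to affine there that `u - U` has second differences of order `L²`.

The second alternative is excluded by the error estimate. By pigeonhole, part of the edge of length
`L / n` lies in one of the `n` triangles of a fixed cover of `closure Ω`. That triangle contains a
parallelogram resting on this part, with side lengths of order at least `L`. Large second
differences on one side force the energy to be at least a constant times `L⁴`
(`pow_four_le_energy_of_second_difference`, `Band.length_le_variation_or`), which contradicts `|u -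
U|² ≤ Cu² h^(2α)` when `L ≥ CL h^(2α/5)` with `CL` large.

In the first alternative the jumps of the slope are paid for by gradient errors. At `p i` the
gradient on `Kt i` agrees with those on `K (i - 1)` and `K i` along the two shared edges. The
directions of these edges differ from each other and from the edge of the band by at most `2 sin (π
- αt i)`, so the jump is at most this sine times the sum of the distances of the three gradients
from any fixed vector (`Band.abs_slope_sub_le`). With that vector equal to `∇u (p i)`, the squared
jump, weighted by `area (Kt i) / sin²`, is bounded by the local energy up to a multiple of `h²`
(`Band.weighted_jump_sq_le`). Cauchy-Schwarz over the `N` jumps produces `L² / N`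
(`Band.minOver_mul_le`).

On summation over the bands, the elements `Kt i` contribute the energy on the bands with a factor
free of `CK`. The elements `K i` carry `CK`, and their energy is bounded by the global error
estimate, so it goes into `A₂`; hence `C₁` does not depend on `CK`. -/

namespace FEMBand

/-! ### Triangles in the plane and the gradient of the exact solution -/

lemma convex_body (s : Finset Plane) : Convex ℝ (body s) := convex_convexHull ℝ _

lemma isCompact_body (s : Finset Plane) : IsCompact (body s) :=
  s.finite_toSet.isCompact_convexHull ℝ

lemma isClosed_body (s : Finset Plane) : IsClosed (body s) := (isCompact_body s).isClosed

lemma mem_body_of_mem {s : Finset Plane} {x : Plane} (hx : x ∈ s) : x ∈ body s :=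
  subset_convexHull ℝ _ hx

lemma volume_body_eq_zero {s : Finset Plane} (hs : s.card ≤ 2) : volume (body s) = 0 := by
  classical
  rcases s.eq_empty_or_nonempty with rfl | hne
  · simp [body]
  have hcard : s.card = (s.card - 1) + 1 := by have := hne.card_pos; omega
  have h1 : Module.finrank ℝ (vectorSpan ℝ (s : Set Plane)) ≤ s.card - 1 := by
    have h := finrank_vectorSpan_image_finset_le ℝ (id : Plane → Plane) s hcard
    rwa [Finset.coe_image, image_id] at h
  have h2 : affineSpan ℝ (s : Set Plane) ≠ ⊤ := by
    intro h
    have h3 : vectorSpan ℝ (s : Set Plane) = ⊤ := by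
      rw [← direction_affineSpan, h, AffineSubspace.direction_top]
    rw [h3, finrank_top, finrank_euclideanSpace_fin] at h1
    omega
  exact measure_mono_null (convexHull_subset_affineSpan _)
    (Measure.addHaar_affineSubspace volume _ h2)

lemma ae_notMem_frontier_body (s : Finset Plane) : ∀ᵐ x : Plane, x ∉ frontier (body s) :=
  measure_eq_zero_iff_ae_notMem.1 ((convex_body s).addHaar_frontier volume)

lemma exists_ball_subset_body {s : Finset Plane} (hs : s.card = 3)
    (hi : AffineIndependent ℝ ((↑) : s → Plane)) :
    ∃ z : Plane, ∃ r > 0, Metric.ball z r ⊆ body s := by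
  have h1 : affineSpan ℝ (s : Set Plane) = ⊤ := by
    have := (hi.affineSpan_eq_top_iff_card_eq_finrank_add_one).2 (by simp [hs])
    simpa using this
  obtain ⟨z, hz⟩ := interior_convexHull_nonempty_iff_affineSpan_eq_top.2 h1
  obtain ⟨r, hr, hb⟩ := Metric.isOpen_iff.1 isOpen_interior z hz
  exact ⟨z, r, hr, hb.trans interior_subset⟩

lemma uExact_eq (x : Plane) : uExact x = ‖x‖ ^ 2 := by
  simp [uExact, EuclideanSpace.norm_sq_eq, Fin.sum_univ_two]

lemma hasGradientAt_uExact (x : Plane) : HasGradientAt uExact ((2 : ℝ) • x) x := by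
  rw [hasGradientAt_iff_hasFDerivAt]
  have h := (hasStrictFDerivAt_norm_sq x).hasFDerivAt
  have h1 : uExact = fun x : Plane => ‖x‖ ^ 2 := funext uExact_eq
  rw [h1]
  refine h.congr_fderiv ?_
  ext y
  simp

/-! ### Elements up to null sets and elementwise gradients -/

section Triangulation

variable {T : Geometry.SimplicialComplex ℝ Plane} {Ω : Set Plane} {U : Plane → ℝ}

lemma exists_affine_on_body (hU : U ∈ X T) {s : Finset Plane} (hs : s ∈ elements T) :
    ∃ (G : Plane) (c : ℝ), ∀ x ∈ body s, U x = inner ℝ G x + c := by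
  obtain ⟨f, hf⟩ := hU.2 s hs
  refine ⟨(InnerProductSpace.toDual ℝ Plane).symm f.linear.toContinuousLinearMap, f 0, ?_⟩
  intro x hx
  rw [hf hx, InnerProductSpace.toDual_symm_apply]
  have := f.map_vadd 0 x
  simpa using this

/-- The gradient of a finite element function on an element. -/
noncomputable def elementGradient (U : Plane → ℝ) (hU : U ∈ X T) (s : elements T) : Plane :=
  (exists_affine_on_body hU s.2).choose

lemma sub_eq_inner_elementGradient (hU : U ∈ X T) (s : elements T) {x y : Plane}
    (hx : x ∈ body s.1) (hy : y ∈ body s.1) :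
    U x - U y = inner ℝ (elementGradient U hU s) (x - y) := by
  obtain ⟨c, hc⟩ := (exists_affine_on_body hU s.2).choose_spec
  rw [hc x hx, hc y hy, inner_sub_right]
  unfold elementGradient
  ring

lemma hasGradientAt_sub (hU : U ∈ X T) (s : elements T) {x : Plane}
    (hx : x ∈ interior (body s.1)) :
    HasGradientAt (fun x => uExact x - U x) ((2 : ℝ) • x - elementGradient U hU s) x := by
  have h1 : HasGradientAt U (elementGradient U hU s) x := by
    rw [hasGradientAt_iff_hasFDerivAt]
    refine ((InnerProductSpace.toDual ℝ Plane (elementGradient U hU s)).hasFDerivAt.add_const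
      (U x - inner ℝ (elementGradient U hU s) x)).congr_of_eventuallyEq ?_
    filter_upwards [mem_interior_iff_mem_nhds.1 hx] with y hy
    have h2 := sub_eq_inner_elementGradient hU s hy (interior_subset hx)
    rw [inner_sub_right] at h2
    rw [InnerProductSpace.toDual_apply_apply]
    linarith
  have h3 := hasGradientAt_iff_hasFDerivAt.1 (hasGradientAt_uExact x)
  have h4 := h3.sub (hasGradientAt_iff_hasFDerivAt.1 h1)
  rw [hasGradientAt_iff_hasFDerivAt, map_sub]
  exact h4

lemma IsTriangulation.finite_elements (hT : IsTriangulation T Ω) : (elements T).Finite :=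
  hT.finite.subset fun _ hs => hs.1

lemma volume_body_eq_zero_of_notMem_elements {s : Finset Plane} (hs : s ∈ T.faces)
    (hs' : s ∉ elements T) : volume (body s) = 0 := by
  refine volume_body_eq_zero ?_
  have h1 := (T.indep hs).card_le_finrank_succ
  have h2 := Submodule.finrank_le (vectorSpan ℝ (range ((↑) : s → Plane)))
  rw [finrank_euclideanSpace_fin] at h2
  have h3 : s.card ≠ 3 := fun h => hs' ⟨hs, h⟩
  simp only [Fintype.card_coe] at h1
  omega

lemma body_subset_closure (hT : IsTriangulation T Ω) {s : Finset Plane} (hs : s ∈ elements T) :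
    body s ⊆ closure Ω := by
  rw [← hT.space_eq]
  exact Geometry.SimplicialComplex.convexHull_subset_space hs.1

/-- The points of `Ω` outside all elements form an open set covered by the faces with at most two
vertices. These are null, so the open set is empty. -/
lemma closure_eq_biUnion_elements (hT : IsTriangulation T Ω) (hΩ : IsOpen Ω) :
    closure Ω = ⋃ s ∈ elements T, body s := by
  apply Subset.antisymm
  · have hcl : IsClosed (⋃ s ∈ elements T, body s) :=
      hT.finite_elements.isClosed_biUnion fun s _ => isClosed_body s
    refine closure_minimal (fun x hx => ?_) hcl
    by_contra hxE
    have hsub : Ω \ (⋃ s ∈ elements T, body s) ⊆ ⋃ s ∈ T.faces \ elements T, body s := by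
      rintro y ⟨hy, hyE⟩
      have h1 : y ∈ T.space := by rw [hT.space_eq]; exact subset_closure hy
      obtain ⟨s, hs, hys⟩ := Geometry.SimplicialComplex.mem_space_iff.1 h1
      refine mem_biUnion (x := s) ⟨hs, fun hse => hyE (mem_biUnion hse hys)⟩ hys
    have hnull : volume (⋃ s ∈ T.faces \ elements T, body s) = 0 :=
      (measure_biUnion_null_iff (hT.finite.subset sdiff_subset).countable).2
        fun s hs => volume_body_eq_zero_of_notMem_elements hs.1 hs.2
    have hopen : IsOpen (Ω \ (⋃ s ∈ elements T, body s)) := hΩ.sdiff hcl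
    exact (hopen.measure_pos volume ⟨x, hx, hxE⟩).ne' (measure_mono_null hsub hnull)
  · exact iUnion₂_subset fun s hs => body_subset_closure hT hs

lemma ae_mem_interior_body (hT : IsTriangulation T Ω) (hΩ : IsOpen Ω) :
    ∀ᵐ x : Plane, x ∈ closure Ω → ∃ s ∈ elements T, x ∈ interior (body s) := by
  have h1 : ∀ᵐ x : Plane, ∀ s ∈ elements T, x ∉ frontier (body s) :=
    (ae_ball_iff hT.finite_elements.countable).2 fun s _ => ae_notMem_frontier_body s
  filter_upwards [h1] with x hx hxΩ
  rw [closure_eq_biUnion_elements hT hΩ] at hxΩ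
  obtain ⟨s, hs, hxs⟩ := mem_iUnion₂.1 hxΩ
  refine ⟨s, hs, ?_⟩
  by_contra hxi
  exact hx s hs ⟨subset_closure hxs, hxi⟩

/-- Almost every point of `closure Ω` is interior to an element, hence interior to `closure Ω`, and
absence of slits puts it in `Ω`. This lets the seminorm on `Ω` be computed on `closure Ω`. -/
lemma ae_mem_of_mem_closure (hT : IsTriangulation T Ω) (hΩ : IsPolygonalDomain Ω) :
    ∀ᵐ x : Plane, x ∈ closure Ω → x ∈ Ω := by
  filter_upwards [ae_mem_interior_body hT hΩ.isOpen] with x hx hxΩ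
  obtain ⟨s, hs, hxs⟩ := hx hxΩ
  rw [← hΩ.interior_closure]
  exact interior_mono (body_subset_closure hT hs) hxs

lemma closure_ae_eq (hT : IsTriangulation T Ω) (hΩ : IsPolygonalDomain Ω) :
    (closure Ω : Set Plane) =ᵐ[volume] Ω := by
  filter_upwards [ae_mem_of_mem_closure hT hΩ] with x hx
  exact propext ⟨hx, fun h => subset_closure h⟩

lemma IsPolygonalDomain.isCompact_closure (hΩ : IsPolygonalDomain Ω) : IsCompact (closure Ω) := by
  obtain ⟨F, -, hF⟩ := hΩ.polygonal
  rw [hF]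
  exact F.isCompact_biUnion fun s _ => isCompact_body s

lemma interior_body_ae_eq (s : Finset Plane) : interior (body s) =ᵐ[volume] body s :=
  interior_ae_eq_of_null_frontier ((convex_body s).addHaar_frontier volume)

/-- By conformity the overlap lies in the hull of the common vertices. There are at most two of
these, so a nonempty open overlap would be null. -/
lemma disjoint_interior_body {s t : Finset Plane} (hs : s ∈ elements T) (ht : t ∈ elements T)
    (hst : s ≠ t) : Disjoint (interior (body s)) (interior (body t)) := by
  classical
  rw [disjoint_iff_inter_eq_empty]
  by_contra hne
  have hpos := (isOpen_interior.inter isOpen_interior).measure_pos volume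
    (nonempty_iff_ne_empty.2 hne)
  refine hpos.ne' (measure_mono_null (t := body (s ∩ t)) ?_ (volume_body_eq_zero ?_))
  · refine (inter_subset_inter interior_subset interior_subset).trans ?_
    have := T.inter_subset_convexHull hs.1 ht.1
    simpa [body] using this
  · by_contra hc
    have h1 : s ∩ t = s :=
      Finset.eq_of_subset_of_card_le Finset.inter_subset_left (by rw [hs.2]; omega)
    have h2 : s ∩ t = t :=
      Finset.eq_of_subset_of_card_le Finset.inter_subset_right (by rw [ht.2]; omega)
    exact hst (h1.symm.trans h2)

lemma sum_setIntegral_body_le {f : Plane → ℝ} (hf : ∀ x, 0 ≤ f x) {S : Set Plane}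
    (hfS : IntegrableOn f S) {E : Finset (Finset Plane)} (hE : ∀ s ∈ E, s ∈ elements T)
    (hES : ∀ s ∈ E, body s ⊆ S) : ∑ s ∈ E, ∫ x in body s, f x ≤ ∫ x in S, f x := by
  have h1 : ∑ s ∈ E, ∫ x in body s, f x = ∫ x in ⋃ s ∈ E, interior (body s), f x := by
    rw [integral_biUnion_finset E (fun s _ => isOpen_interior.measurableSet)
      (fun s hs t ht hst => disjoint_interior_body (hE s hs) (hE t ht) hst)
      (fun s hs => hfS.mono_set (interior_subset.trans (hES s hs)))]
    exact Finset.sum_congr rfl fun s _ => (setIntegral_congr_set (interior_body_ae_eq s)).symm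
  rw [h1]
  exact setIntegral_mono_set hfS (Filter.Eventually.of_forall hf)
    (iUnion₂_subset fun s hs => interior_subset.trans (hES s hs)).eventuallyLE

lemma normSq_gradient_ae_eq (hU : U ∈ X T) (s : elements T) :
    (fun x => ‖gradient (fun x => uExact x - U x) x‖ ^ 2)
      =ᵐ[volume.restrict (body s.1)] fun x => ‖(2 : ℝ) • x - elementGradient U hU s‖ ^ 2 := by
  rw [← Measure.restrict_congr_set (interior_body_ae_eq s.1)]
  filter_upwards [ae_restrict_mem isOpen_interior.measurableSet] with x hx
  rw [(hasGradientAt_sub hU s hx).gradient]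

lemma integrableOn_normSq_gradient (hT : IsTriangulation T Ω) (hΩ : IsOpen Ω) (hU : U ∈ X T) :
    IntegrableOn (fun x => ‖gradient (fun x => uExact x - U x) x‖ ^ 2) (closure Ω) := by
  rw [closure_eq_biUnion_elements hT hΩ, integrableOn_finite_biUnion hT.finite_elements]
  intro s hs
  refine Integrable.congr ?_ (normSq_gradient_ae_eq hU ⟨s, hs⟩).symm
  have : ContinuousOn (fun x => ‖(2 : ℝ) • x - elementGradient U hU ⟨s, hs⟩‖ ^ 2) (body s) := by
    fun_prop
  exact this.integrableOn_compact (isCompact_body s)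

end Triangulation

/-! ### Increments of the error along a line -/

section Line

/-- A bound of the increment of a function of one variable by the integral of its derivative. -/
lemma enorm_sub_le_lintegral_deriv {φ : ℝ → ℝ} {a b : ℝ} (hab : a ≤ b)
    (hc : ContinuousOn φ (Icc a b)) {E : Set ℝ} (hE : E.Countable)
    (hd : ∀ t ∈ Ioo a b \ E, DifferentiableAt ℝ φ t) :
    ‖φ b - φ a‖ₑ ≤ ∫⁻ t in Icc a b, ‖deriv φ t‖ₑ := by
  -- An infinite right-hand side makes the bound trivial; otherwise the derivative is integrable and
  -- the fundamental theorem with a countable exceptional set applies.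
  rcases eq_or_ne (∫⁻ t in Icc a b, ‖deriv φ t‖ₑ) ⊤ with h | h
  · rw [h]; exact le_top
  have hint : IntegrableOn (deriv φ) (Icc a b) :=
    ⟨(measurable_deriv φ).aestronglyMeasurable, lt_top_iff_ne_top.2 h⟩
  have hii : IntervalIntegrable (deriv φ) volume a b :=
    (intervalIntegrable_iff_integrableOn_Icc_of_le hab).2 hint
  have hftc := integral_eq_of_hasDerivAt_off_countable φ (deriv φ) hE
    (by rwa [uIcc_of_le hab])
    (fun t ht => (hd t (by simpa only [min_eq_left hab, max_eq_right hab] using ht)).hasDerivAt) hii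
  rw [← hftc, intervalIntegral.integral_of_le hab]
  exact (enorm_integral_le_lintegral_enorm _).trans (lintegral_mono_set Ioc_subset_Icc_self)

lemma line_inter_body_eq_Icc {s : Finset Plane} {A d : Plane} {a b : ℝ}
    (hne : ({t : ℝ | A + t • d ∈ body s} ∩ Icc a b).Nonempty) :
    ∃ c e : ℝ, c ≤ e ∧ {t : ℝ | A + t • d ∈ body s} ∩ Icc a b = Icc c e := by
  have h1 : {t : ℝ | A + t • d ∈ body s} = AffineMap.lineMap A (A + d) ⁻¹' body s := by
    ext t
    simp [AffineMap.lineMap_apply, add_comm]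
  have hconv : Convex ℝ ({t : ℝ | A + t • d ∈ body s} ∩ Icc a b) := by
    rw [h1]
    exact ((convex_body s).affine_preimage (AffineMap.lineMap A (A + d) : ℝ →ᵃ[ℝ] Plane)).inter
      (convex_Icc a b)
  have hcomp : IsCompact ({t : ℝ | A + t • d ∈ body s} ∩ Icc a b) :=
    isCompact_Icc.inter_left ((isClosed_body s).preimage (by fun_prop))
  have h2 := eq_Icc_of_connected_compact ⟨hne, hconv.isPreconnected⟩ hcomp
  refine ⟨_, _, ?_, h2⟩
  rw [h2] at hne
  exact nonempty_Icc.1 hne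

/-- By convexity a line meets each element in an interval, so only the endpoints of finitely many
intervals are exceptional. This holds even if the line runs along edges, where `U` itself need not
be differentiable. -/
lemma exists_countable_differentiableAt_comp_line {T : Geometry.SimplicialComplex ℝ Plane}
    {Ω : Set Plane} {U : Plane → ℝ} (hT : IsTriangulation T Ω) (hΩ : IsOpen Ω) (hU : U ∈ X T)
    {A d : Plane} {a b : ℝ} (hΓ : ∀ t ∈ Icc a b, A + t • d ∈ closure Ω) :
    ∃ E : Set ℝ, E.Countable ∧
      ∀ t ∈ Ioo a b \ E, DifferentiableAt ℝ (fun t => U (A + t • d)) t := by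
  set P : Finset Plane → Set ℝ := fun s => {t | A + t • d ∈ body s} ∩ Icc a b
  refine ⟨⋃ s ∈ elements T, frontier (P s), ?_, ?_⟩
  · refine hT.finite_elements.countable.biUnion fun s _ => ?_
    rcases (P s).eq_empty_or_nonempty with he | hne
    · simp [he]
    · obtain ⟨c, e, hce, h1⟩ := line_inter_body_eq_Icc hne
      have h2 : P s = Icc c e := h1
      rw [h2, frontier_Icc hce]
      exact (Set.toFinite _).countable
  · rintro t ⟨ht, htE⟩
    have h1 := hΓ t (Ioo_subset_Icc_self ht)
    rw [closure_eq_biUnion_elements hT hΩ] at h1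
    obtain ⟨s, hs, hts⟩ := mem_iUnion₂.1 h1
    have h2 : t ∈ P s := ⟨hts, Ioo_subset_Icc_self ht⟩
    have h3 : t ∈ interior (P s) := by
      by_contra h
      exact htE (mem_biUnion hs ⟨subset_closure h2, h⟩)
    have h4 : HasDerivAt (fun τ : ℝ => U (A + t • d)
        + (τ - t) * inner ℝ (elementGradient U hU ⟨s, hs⟩) d)
        (1 * inner ℝ (elementGradient U hU ⟨s, hs⟩) d) t :=
      (((hasDerivAt_id t).sub_const t).mul_const _).const_add _
    refine (h4.congr_of_eventuallyEq ?_).differentiableAt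
    filter_upwards [mem_interior_iff_mem_nhds.1 h3] with τ hτ
    have h5 := sub_eq_inner_elementGradient hU ⟨s, hs⟩ hτ.1 hts
    have h6 : A + τ • d - (A + t • d) = (τ - t) • d := by module
    rw [h6, inner_smul_right] at h5
    linarith

/-- The chain rule identifies the derivative along the line only where the error is differentiable
in the plane. This is assumed almost everywhere on the line; Fubini later supplies it for almost
every line of a family. -/
lemma enorm_sub_le_lintegral_gradient {T : Geometry.SimplicialComplex ℝ Plane}
    {Ω : Set Plane} {U : Plane → ℝ} (hT : IsTriangulation T Ω) (hΩ : IsOpen Ω) (hU : U ∈ X T)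
    {v : Plane → ℝ} (hv : v = fun x => uExact x - U x)
    {A d : Plane} {a b : ℝ} (hab : a ≤ b) (hΓ : ∀ t ∈ Icc a b, A + t • d ∈ closure Ω)
    (hdiff : ∀ᵐ t, t ∈ Icc a b → DifferentiableAt ℝ v (A + t • d)) :
    ‖v (A + b • d) - v (A + a • d)‖ₑ
      ≤ ‖d‖ₑ * ∫⁻ t in Icc a b, ‖gradient v (A + t • d)‖ₑ := by
  obtain ⟨E, hE, hd⟩ := exists_countable_differentiableAt_comp_line hT hΩ hU hΓ
  have hline : ∀ t, HasDerivAt (fun t : ℝ => A + t • d) d t := fun t => by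
    simpa using ((hasDerivAt_id t).smul_const d).const_add A
  have hud : ∀ x, DifferentiableAt ℝ uExact x := fun x =>
    (hasGradientAt_iff_hasFDerivAt.1 (hasGradientAt_uExact x)).differentiableAt
  have hcont : ContinuousOn (fun t : ℝ => v (A + t • d)) (Icc a b) := by
    rw [hv]
    refine ContinuousOn.sub ?_ ?_
    · exact (Continuous.comp (g := uExact)
        (continuous_iff_continuousAt.2 fun x => (hud x).continuousAt)
        (by fun_prop)).continuousOn
    · refine hU.1.comp (by fun_prop) fun t ht => ?_
      rw [hT.space_eq]
      exact hΓ t ht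
  refine (enorm_sub_le_lintegral_deriv (φ := fun t : ℝ => v (A + t • d)) hab hcont hE ?_).trans ?_
  · intro t ht
    rw [hv]
    exact DifferentiableAt.sub ((hud _).comp t (hline t).differentiableAt) (hd t ht)
  · rw [← lintegral_const_mul' _ _ enorm_ne_top]
    refine lintegral_mono_ae ?_
    filter_upwards [ae_restrict_of_ae hdiff, ae_restrict_mem measurableSet_Icc] with t h1 h2
    have h3 := (h1 h2).hasGradientAt
    have h4 := (hasGradientAt_iff_hasFDerivAt.1 h3).comp_hasDerivAt t (hline t)
    have h5 : deriv (fun t : ℝ => v (A + t • d)) t = inner ℝ (gradient v (A + t • d)) d := by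
      rw [← InnerProductSpace.toDual_apply_apply]
      exact h4.deriv
    rw [h5, mul_comm]
    have h6 := norm_inner_le_norm (𝕜 := ℝ) (gradient v (A + t • d)) d
    rw [← ofReal_norm, ← ofReal_norm, ← ofReal_norm,
      ← ENNReal.ofReal_mul (norm_nonneg _)]
    exact ENNReal.ofReal_le_ofReal h6

end Line

/-! ### Oblique coordinates in the plane -/

section ChangeOfVariables

/-- Affine coordinates of the plane with origin `A` and axes `g`, `d`. -/
lemma map_affine_coordinates (A g d : Plane) (hδ : g 0 * d 1 - g 1 * d 0 ≠ 0) :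
    Measure.map (fun z : ℝ × ℝ => A + z.1 • g + z.2 • d) volume
      = ENNReal.ofReal |(g 0 * d 1 - g 1 * d 0)⁻¹| • (volume : Measure Plane) := by
  set M : Matrix (Fin 2) (Fin 2) ℝ := !![g 0, d 0; g 1, d 1] with hM
  have hdet : M.det = g 0 * d 1 - g 1 * d 0 := by
    rw [hM, Matrix.det_fin_two_of]; ring
  have h1 : (fun z : ℝ × ℝ => A + z.1 • g + z.2 • d)
      = (fun x => A + x) ∘ (WithLp.toLp 2) ∘ (Matrix.toLin' M) ∘
        (MeasurableEquiv.finTwoArrow (α := ℝ)).symm := by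
    funext z
    ext i
    fin_cases i <;>
      simp [hM, Matrix.toLin'_apply, MeasurableEquiv.finTwoArrow, MeasurableEquiv.piFinTwo] <;> ring
  have hmL : Measurable (Matrix.toLin' M) :=
    (LinearMap.continuous_of_finiteDimensional _).measurable
  have hmp := (PiLp.volume_preserving_toLp (Fin 2))
  have hm2 : Measurable ((MeasurableEquiv.finTwoArrow (α := ℝ)).symm) := MeasurableEquiv.measurable _
  rw [h1, ← Measure.map_map (measurable_const_add A) (hmp.measurable.comp (hmL.comp hm2)),
    ← Measure.map_map hmp.measurable (hmL.comp hm2), ← Measure.map_map hmL hm2,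
    (volume_preserving_finTwoArrow ℝ).symm.map_eq,
    Real.map_matrix_volume_pi_eq_smul_volume_pi (by rwa [hdet]), Measure.map_smul, hmp.map_eq,
    Measure.map_smul, (measurePreserving_add_left volume A).map_eq, hdet]

lemma lintegral_rectangle_le (A g d : Plane) (hδ : g 0 * d 1 - g 1 * d 0 ≠ 0)
    {f : Plane → ENNReal} (hf : Measurable f) {S : Set Plane} (hS : MeasurableSet S) {a b : ℝ}
    (hmem : ∀ t ∈ Icc 0 a, ∀ y ∈ Icc 0 b, A + t • g + y • d ∈ S) :
    ∫⁻ t in Icc 0 a, ∫⁻ y in Icc 0 b, f (A + t • g + y • d)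
      ≤ ENNReal.ofReal |(g 0 * d 1 - g 1 * d 0)⁻¹| * ∫⁻ x in S, f x := by
  have hΦ : Measurable fun z : ℝ × ℝ => A + z.1 • g + z.2 • d := by fun_prop
  have hfS : Measurable (S.indicator f) := hf.indicator hS
  have hcomp : Measurable fun z : ℝ × ℝ => S.indicator f (A + z.1 • g + z.2 • d) := hfS.comp hΦ
  calc ∫⁻ t in Icc 0 a, ∫⁻ y in Icc 0 b, f (A + t • g + y • d)
      ≤ ∫⁻ t : ℝ, ∫⁻ y : ℝ, S.indicator f (A + t • g + y • d) := by
        rw [← lintegral_indicator measurableSet_Icc]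
        refine lintegral_mono fun t => ?_
        by_cases ht : t ∈ Icc 0 a
        · rw [indicator_of_mem ht, ← lintegral_indicator measurableSet_Icc]
          refine lintegral_mono fun y => ?_
          by_cases hy : y ∈ Icc 0 b
          · simp only [indicator_of_mem hy, indicator_of_mem (hmem t ht y hy), le_refl]
          · simp [indicator_of_notMem hy]
        · simp [indicator_of_notMem ht]
    _ = ∫⁻ z : ℝ × ℝ, S.indicator f (A + z.1 • g + z.2 • d) := by
        rw [Measure.volume_eq_prod, lintegral_prod _ hcomp.aemeasurable]
    _ = _ := by
        rw [← lintegral_map hfS hΦ, map_affine_coordinates A g d hδ, lintegral_smul_measure,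
          lintegral_indicator hS, smul_eq_mul]

lemma ae_affine_coordinates (A g d : Plane) (hδ : g 0 * d 1 - g 1 * d 0 ≠ 0) {P : Plane → Prop}
    (hP : ∀ᵐ x, P x) : ∀ᵐ z : ℝ × ℝ, P (A + z.1 • g + z.2 • d) := by
  have hΦ : Measurable fun z : ℝ × ℝ => A + z.1 • g + z.2 • d := by fun_prop
  refine ae_of_ae_map hΦ.aemeasurable ?_
  rw [map_affine_coordinates A g d hδ]
  exact Measure.ae_smul_measure hP _

end ChangeOfVariables

/-! ### Second differences bound the Dirichlet energy -/

section SecondDifference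

/-- If the second differences of `V` along the bottom edge of a rectangle are large, then so is the
Dirichlet energy of `V`. -/
lemma le_lintegral_of_second_difference {V : ℝ → ℝ → ℝ} {H : ℝ → ℝ → ENNReal}
    (hH : Measurable (Function.uncurry H)) {m σ D : ℝ} (hm : 0 < m)
    (hDσ : D * σ ≤ m) (hD : 0 ≤ D)
    (hvert : ∀ᵐ t, t ∈ Icc 0 (3 * m) → ∀ y ∈ Icc 0 σ,
      ‖V t y - V t 0‖ₑ ≤ ENNReal.ofReal D * ∫⁻ s in Icc 0 σ, H t s)
    (hhor : ∀ᵐ s, s ∈ Icc 0 σ → ∀ a b, 0 ≤ a → a ≤ b → b ≤ 3 * m →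
      ‖V b s - V a s‖ₑ ≤ ∫⁻ t in Icc 0 (3 * m), H t s)
    (hdiff : ∀ x ∈ Icc 0 m, m ^ 2 ≤ |V (x + 2 * m) 0 - 2 * V (x + m) 0 + V x 0|) :
    ENNReal.ofReal (m ^ 2 * σ) ≤ 6 * ∫⁻ t in Icc 0 (3 * m), ∫⁻ s in Icc 0 σ, H t s := by
  set J : ℝ → ENNReal := (Icc 0 (3 * m)).indicator fun t => ∫⁻ s in Icc 0 σ, H t s with hJ
  set I := ∫⁻ t in Icc 0 (3 * m), ∫⁻ s in Icc 0 σ, H t s with hI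
  have hmeas : Measurable fun t => ∫⁻ s in Icc 0 σ, H t s := hH.lintegral_prod_right'
  have hJm : Measurable J := hmeas.indicator measurableSet_Icc
  have hJI : ∫⁻ t, J t = I := lintegral_indicator measurableSet_Icc _
  have hswap : ∫⁻ s in Icc 0 σ, ∫⁻ t in Icc 0 (3 * m), H t s = I :=
    lintegral_lintegral_swap (f := fun s t => H t s) (hH.comp measurable_swap).aemeasurable
  have hshift : ∀ c : ℝ, ∀ᵐ x, x + c ∈ Icc 0 (3 * m) → ∀ y ∈ Icc 0 σ,
      ‖V (x + c) y - V (x + c) 0‖ₑ ≤ ENNReal.ofReal D * J (x + c) := by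
    intro c
    have h1 := (measurePreserving_add_right volume c).quasiMeasurePreserving.ae hvert
    filter_upwards [h1] with x hx hxc y hy
    rw [hJ, indicator_of_mem hxc]
    exact hx hxc y hy
  have hJc : ∀ c : ℝ, ∫⁻ x in Icc 0 m, J (x + c) ≤ I := fun c => by
    rw [← hJI, ← lintegral_add_right_eq_self J c]
    exact setLIntegral_le_lintegral _ _
  have hpt : ∀ᵐ x, x ∈ Icc 0 m → ENNReal.ofReal (m ^ 2 * σ) ≤
      2 * I + ENNReal.ofReal (D * σ) * (J (x + 2 * m) + 2 * J (x + m) + J (x + 0)) := by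
    filter_upwards [hshift (2 * m), hshift m, hshift 0] with x h2 h1 h0 hx
    have hx' := hx
    obtain ⟨hx0, hxm⟩ := hx
    set W := J (x + 2 * m) + 2 * J (x + m) + J (x + 0) with hW
    -- The second difference on the bottom edge is compared with the one at height `s`. The latter
    -- consists of two horizontal increments, and the passage costs three vertical increments, the
    -- middle one counted twice.
    have hs : ∀ᵐ s, s ∈ Icc 0 σ → ENNReal.ofReal (m ^ 2) ≤
        2 * (∫⁻ t in Icc 0 (3 * m), H t s) + ENNReal.ofReal D * W := by
      filter_upwards [hhor] with s hs hsσ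
      have e1 := hs hsσ (x + m) (x + 2 * m) (by linarith) (by linarith) (by linarith)
      have e2 := hs hsσ x (x + m) (by linarith) (by linarith) (by linarith)
      have f2 := h2 ⟨by linarith, by linarith⟩ s hsσ
      have f1 := h1 ⟨by linarith, by linarith⟩ s hsσ
      have f0 := h0 ⟨by linarith, by linarith⟩ s hsσ
      rw [add_zero] at f0
      have hle : ENNReal.ofReal (m ^ 2) ≤
          ‖V (x + 2 * m) s - V (x + m) s‖ₑ + ‖V (x + m) s - V x s‖ₑ +
          (‖V (x + 2 * m) s - V (x + 2 * m) 0‖ₑ + 2 * ‖V (x + m) s - V (x + m) 0‖ₑ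
            + ‖V x s - V x 0‖ₑ) := by
        have hd := hdiff x hx'
        have h2' : (2 : ENNReal) = ENNReal.ofReal 2 := by simp
        simp only [Real.enorm_eq_ofReal_abs]
        rw [h2', ← ENNReal.ofReal_mul (by norm_num), ← ENNReal.ofReal_add (by positivity)
          (by positivity), ← ENNReal.ofReal_add (by positivity) (by positivity),
          ← ENNReal.ofReal_add (by positivity) (by positivity),
          ← ENNReal.ofReal_add (by positivity) (by positivity)]
        refine ENNReal.ofReal_le_ofReal (hd.trans ?_)
        have a1 := abs_le.1 (le_refl |V (x + 2 * m) s - V (x + m) s|)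
        have a2 := abs_le.1 (le_refl |V (x + m) s - V x s|)
        have a3 := abs_le.1 (le_refl |V (x + 2 * m) s - V (x + 2 * m) 0|)
        have a4 := abs_le.1 (le_refl |V (x + m) s - V (x + m) 0|)
        have a5 := abs_le.1 (le_refl |V x s - V x 0|)
        rw [abs_le]
        constructor <;> linarith [a1.1, a1.2, a2.1, a2.2, a3.1, a3.2, a4.1, a4.2, a5.1, a5.2]
      rw [add_zero] at hW
      calc ENNReal.ofReal (m ^ 2) ≤ _ := hle
        _ ≤ (∫⁻ t in Icc 0 (3 * m), H t s) + (∫⁻ t in Icc 0 (3 * m), H t s) +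
          (ENNReal.ofReal D * J (x + 2 * m) + 2 * (ENNReal.ofReal D * J (x + m))
            + ENNReal.ofReal D * J x) := by
            gcongr
        _ = _ := by rw [hW]; ring
    have h3 := setLIntegral_mono_ae' measurableSet_Icc hs
    rw [setLIntegral_const, lintegral_add_right _ measurable_const, setLIntegral_const,
      lintegral_const_mul' _ _ (by simp), hswap, Real.volume_Icc, sub_zero,
      ← ENNReal.ofReal_mul (by positivity)] at h3
    refine h3.trans (le_of_eq ?_)
    rw [ENNReal.ofReal_mul hD]
    ring
  have h4 := setLIntegral_mono_ae' measurableSet_Icc hpt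
  rw [setLIntegral_const, lintegral_add_left measurable_const, setLIntegral_const,
    lintegral_const_mul' _ _ (by simp), lintegral_add_left (by fun_prop),
    lintegral_add_left (by fun_prop), lintegral_const_mul' _ _ (by simp), Real.volume_Icc,
    sub_zero] at h4
  -- After integration in `x`, each shifted `J` contributes at most `I`. The total is `2 + 4 = 6`
  -- copies of `I`, and the common factor `m` cancels.
  have h5 : ENNReal.ofReal (m ^ 2 * σ) * ENNReal.ofReal m ≤ (6 * I) * ENNReal.ofReal m := by
    calc _ ≤ _ := h4
      _ ≤ 2 * I * ENNReal.ofReal m + ENNReal.ofReal m * (I + 2 * I + I) := by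
        gcongr
        · exact hJc _
        · exact hJc _
        · exact hJc _
      _ = _ := by ring
  rwa [ENNReal.mul_le_mul_iff_left (by simpa using hm) (by simp)] at h5

/-- Young's inequality passes from the integral of `H` to that of `H²`. The weight `m / 36` is
chosen so that its term, `6 * (m / 36) * (3 * m * σ) = m² σ / 2`, is absorbed on the left. -/
lemma pow_mul_le_of_lintegral_le {H : ℝ → ℝ → ENNReal} {m σ q : ℝ} (hm : 0 < m) (hσ : 0 < σ) (hq : 0 ≤ q)
    (hV : ENNReal.ofReal (m ^ 2 * σ) ≤ 6 * ∫⁻ t in Icc 0 (3 * m), ∫⁻ s in Icc 0 σ, H t s)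
    (hQ : ∫⁻ t in Icc 0 (3 * m), ∫⁻ y in Icc 0 σ, H t y ^ 2 ≤ ENNReal.ofReal q) :
    m ^ 3 * σ ≤ 432 * q := by
  have hm36 : ENNReal.ofReal (m / 36) ≠ 0 := by simpa using (by positivity : 0 < m / 36)
  have hinv : (ENNReal.ofReal (m / 36))⁻¹ ≠ ⊤ := ENNReal.inv_ne_top.2 hm36
  have hyoung : ∀ a : ENNReal, a ≤ ENNReal.ofReal (m / 36)
      + (ENNReal.ofReal (m / 36))⁻¹ * a ^ 2 := by
    intro a
    rcases le_total a (ENNReal.ofReal (m / 36)) with h | h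
    · exact h.trans le_self_add
    · calc a = (ENNReal.ofReal (m / 36))⁻¹ * (ENNReal.ofReal (m / 36) * a) := by
            rw [← mul_assoc, ENNReal.inv_mul_cancel hm36 ENNReal.ofReal_ne_top, one_mul]
        _ ≤ (ENNReal.ofReal (m / 36))⁻¹ * (a * a) := by gcongr
        _ = (ENNReal.ofReal (m / 36))⁻¹ * a ^ 2 := by rw [sq]
        _ ≤ _ := le_add_self
  have hsum : ∫⁻ t in Icc 0 (3 * m), ∫⁻ y in Icc 0 σ, H t y ≤
      ENNReal.ofReal (m / 36 * (3 * m * σ)) + ENNReal.ofReal ((m / 36)⁻¹ * q) := by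
    calc ∫⁻ t in Icc 0 (3 * m), ∫⁻ y in Icc 0 σ, H t y
        ≤ ∫⁻ t in Icc 0 (3 * m), ∫⁻ y in Icc 0 σ, (ENNReal.ofReal (m / 36)
          + (ENNReal.ofReal (m / 36))⁻¹ * H t y ^ 2) :=
          lintegral_mono fun t => lintegral_mono fun y => hyoung _
      _ = ENNReal.ofReal (m / 36) * ENNReal.ofReal σ * ENNReal.ofReal (3 * m)
          + (ENNReal.ofReal (m / 36))⁻¹ *
            ∫⁻ t in Icc 0 (3 * m), ∫⁻ y in Icc 0 σ, H t y ^ 2 := by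
          simp_rw [lintegral_add_left measurable_const, lintegral_const_mul' _ _ hinv,
            setLIntegral_const, Real.volume_Icc, sub_zero]
      _ ≤ ENNReal.ofReal (m / 36) * ENNReal.ofReal σ * ENNReal.ofReal (3 * m)
          + (ENNReal.ofReal (m / 36))⁻¹ * ENNReal.ofReal q := by gcongr
      _ = _ := by
          rw [← ENNReal.ofReal_inv_of_pos (by positivity), ← ENNReal.ofReal_mul (by positivity),
            ← ENNReal.ofReal_mul (by positivity), ENNReal.ofReal_mul (p := (m / 36)⁻¹)
            (by positivity)]
          ring_nf
  have hfin : m ^ 2 * σ ≤ 6 * (m / 36 * (3 * m * σ) + (m / 36)⁻¹ * q) := by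
    rw [← ENNReal.ofReal_le_ofReal_iff (by positivity), ENNReal.ofReal_mul (p := 6) (by norm_num),
      ENNReal.ofReal_add (by positivity) (by positivity)]
    refine hV.trans ?_
    have h6 : ENNReal.ofReal 6 = 6 := by simp
    rw [h6]
    gcongr
  have h8 : 6 * (m / 36 * (3 * m * σ) + (m / 36)⁻¹ * q) = m ^ 2 * σ / 2 + 216 * q / m := by
    field_simp; ring
  rw [h8] at hfin
  have h9 : m ^ 2 * σ / 2 ≤ 216 * q / m := by linarith
  rw [le_div_iff₀ hm] at h9
  nlinarith

end SecondDifference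

/-! ### Fourth-power lower bound for the energy near a segment -/

/-- In a convex set containing a disc there is a point at a definite distance from a given line. -/
lemma exists_mem_ball_far_from_line {g : Plane} (hg : ‖g‖ = 1) (A z₀ : Plane) {r : ℝ} (hr : 0 < r) :
    ∃ z ∈ Metric.ball z₀ r, r / 2 ≤ |g 0 * (z - A) 1 - g 1 * (z - A) 0| := by
  have hg2 : g 0 ^ 2 + g 1 ^ 2 = 1 := by
    have := uExact_eq g
    rw [hg] at this
    simpa [uExact] using this
  -- The centre is moved by `r / 2` along the normal, away from the line.
  have key : ∀ ε : ℝ, |ε| = 1 → z₀ + (ε * (r / 2)) • !₂[-g 1, g 0] ∈ Metric.ball z₀ r := by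
    intro ε hε
    have h1 : ‖(!₂[-g 1, g 0] : Plane)‖ = 1 := by
      rw [EuclideanSpace.norm_eq, Fin.sum_univ_two]
      simp [add_comm (g 1 ^ 2), hg2]
    rw [mem_ball_iff_norm, add_sub_cancel_left, norm_smul, h1, Real.norm_eq_abs, abs_mul, hε,
      abs_of_pos (by positivity)]
    linarith
  have hval : ∀ ε : ℝ, g 0 * (z₀ + (ε * (r / 2)) • !₂[-g 1, g 0] - A) 1
      - g 1 * (z₀ + (ε * (r / 2)) • !₂[-g 1, g 0] - A) 0
      = (g 0 * (z₀ - A) 1 - g 1 * (z₀ - A) 0) + ε * (r / 2) := by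
    intro ε
    simp
    linear_combination (ε * (r / 2)) * hg2
  rcases le_total 0 (g 0 * (z₀ - A) 1 - g 1 * (z₀ - A) 0) with h | h
  · refine ⟨_, key 1 (by simp), ?_⟩
    rw [hval]
    exact le_trans (by linarith) (le_abs_self _)
  · refine ⟨_, key (-1) (by simp), ?_⟩
    rw [hval]
    exact le_trans (by linarith) (neg_le_abs _)

lemma lintegral_enorm_gradient_sq {T : Geometry.SimplicialComplex ℝ Plane}
    {Ω : Set Plane} {U : Plane → ℝ} (hT : IsTriangulation T Ω) (hΩ : IsOpen Ω) (hU : U ∈ X T) :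
    ∫⁻ x in closure Ω, ‖gradient (fun x => uExact x - U x) x‖ₑ ^ 2
      = ENNReal.ofReal (∫ x in closure Ω, ‖gradient (fun x => uExact x - U x) x‖ ^ 2) := by
  rw [ofReal_integral_eq_lintegral_ofReal (integrableOn_normSq_gradient hT hΩ hU)
    (Filter.Eventually.of_forall fun x => by positivity)]
  refine lintegral_congr fun x => ?_
  rw [ENNReal.ofReal_pow (norm_nonneg _), ofReal_norm]

lemma measurable_gradient (v : Plane → ℝ) : Measurable (gradient v) :=
  (InnerProductSpace.toDual ℝ Plane).symm.continuous.measurable.comp (measurable_fderiv ℝ v)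

lemma ae_differentiableAt_sub {T : Geometry.SimplicialComplex ℝ Plane}
    {Ω : Set Plane} {U : Plane → ℝ} (hT : IsTriangulation T Ω) (hΩ : IsOpen Ω) (hU : U ∈ X T) :
    ∀ᵐ x, x ∈ closure Ω → DifferentiableAt ℝ (fun x => uExact x - U x) x := by
  filter_upwards [ae_mem_interior_body hT hΩ] with x hx hxΩ
  obtain ⟨s, hs, hxs⟩ := hx hxΩ
  exact (hasGradientAt_iff_hasFDerivAt.1 (hasGradientAt_sub hU ⟨s, hs⟩ hxs)).differentiableAt

/-- If `u - U` has large second differences along a segment inside a fixed triangle in `closure Ω`,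
then its energy is bounded from below by the fourth power of the length of the segment. -/
lemma pow_four_le_energy_of_second_difference {T : Geometry.SimplicialComplex ℝ Plane}
    {Ω : Set Plane} {U : Plane → ℝ} (hT : IsTriangulation T Ω) (hΩ : IsOpen Ω) (hU : U ∈ X T)
    {v : Plane → ℝ} (hv : v = fun x => uExact x - U x) {s : Finset Plane}
    (hs : body s ⊆ closure Ω) {z₀ : Plane} {r : ℝ} (hr : 0 < r) (hball : Metric.ball z₀ r ⊆ body s)
    {D : ℝ} (hD : 0 < D) (hdist : ∀ x ∈ closure Ω, ∀ y ∈ closure Ω, dist x y ≤ D)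
    {A g : Plane} (hg : ‖g‖ = 1) {m : ℝ} (hm : 0 < m) (hA : A ∈ body s)
    (hA' : A + (6 * m) • g ∈ body s)
    (hdiff : ∀ t ∈ Icc 0 m, m ^ 2 ≤
      |v (A + (t + 2 * m) • g) - 2 * v (A + (t + m) • g) + v (A + t • g)|) :
    m ^ 4 ≤ 864 * (D / r) * ∫ x in closure Ω, ‖gradient v x‖ ^ 2 := by
  obtain ⟨z, hzb, hz⟩ := exists_mem_ball_far_from_line hg A z₀ hr
  obtain ⟨d, hd⟩ : ∃ d, d = z - A := ⟨_, rfl⟩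
  rw [← hd] at hz
  have hzs := hball hzb
  have hδ : 0 < |g 0 * d 1 - g 1 * d 0| := lt_of_lt_of_le (by positivity) hz
  have hdD : ‖d‖ ≤ D := by
    rw [hd, ← dist_eq_norm]
    exact hdist _ (hs hzs) _ (hs hA)
  have hmD : 6 * m ≤ D := by
    have h1 := hdist _ (hs hA') _ (hs hA)
    rw [dist_eq_norm, add_sub_cancel_left, norm_smul, hg, mul_one, Real.norm_eq_abs,
      abs_of_pos (by positivity)] at h1
    exact h1
  -- With this height, vertical increments are weighted by `D * σ = m`, and `6 * m ≤ D` gives `σ ≤ 1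
  -- / 6`.
  obtain ⟨σ, hσdef⟩ : ∃ σ, σ = m / D := ⟨_, rfl⟩
  have hσ : 0 < σ := by rw [hσdef]; positivity
  have hDσ : D * σ = m := by rw [hσdef]; field_simp
  have hσ6 : σ ≤ 1 / 6 := by rw [hσdef, div_le_iff₀ hD]; linarith
  have hmem : ∀ t ∈ Icc 0 (3 * m), ∀ y ∈ Icc 0 σ, A + t • g + y • d ∈ closure Ω := by
    intro t ht y hy
    have h1 : t / (6 * m) ≤ 1 / 2 := by rw [div_le_iff₀ (by positivity)]; linarith [ht.2]
    have h2 : 0 ≤ t / (6 * m) := div_nonneg ht.1 (by positivity)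
    -- A convex combination of `A`, `A + 6m g` and `z`: only half of the segment is used, so the
    -- weights of the last two points are at most `1 / 2` and `1 / 6`.
    have h4 : A + t • g + y • d = (1 - t / (6 * m) - y) • A
        + ((t / (6 * m)) • (A + (6 * m) • g) + y • z) := by
      have h5 : t • g = (t / (6 * m)) • ((6 * m) • g) := by
        rw [smul_smul]; congr 1; field_simp
      rw [h5, hd]
      module
    rw [h4]
    apply hs
    have := (convex_body s).sum_mem (t := Finset.univ)
      (w := ![1 - t / (6 * m) - y, t / (6 * m), y]) (z := ![A, A + (6 * m) • g, z])
      (by intro i _; fin_cases i <;> simp <;> linarith [hy.1, hy.2])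
      (by simp only [Fin.sum_univ_three]; simp; ring)
      (by intro i _; fin_cases i <;> simp [hA, hA', hzs])
    simpa [Fin.sum_univ_three, add_assoc] using this
  have hdiffae : ∀ᵐ z : ℝ × ℝ, A + z.1 • g + z.2 • d ∈ closure Ω →
      DifferentiableAt ℝ v (A + z.1 • g + z.2 • d) :=
    ae_affine_coordinates A g d (abs_pos.1 hδ) (hv ▸ ae_differentiableAt_sub hT hΩ hU)
  have hG : Measurable fun x => ‖gradient v x‖ₑ := (measurable_gradient v).enorm
  obtain ⟨H, hHdef⟩ : ∃ H : ℝ → ℝ → ENNReal,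
    H = fun t y => ‖gradient v (A + t • g + y • d)‖ₑ := ⟨_, rfl⟩
  have hHm : Measurable (Function.uncurry H) := by
    rw [hHdef]
    exact hG.comp (by fun_prop : Measurable fun z : ℝ × ℝ => A + z.1 • g + z.2 • d)
  have hV := le_lintegral_of_second_difference (V := fun t y => v (A + t • g + y • d)) hHm hm
    hDσ.le hD.le ?_ ?_ ?_
  · obtain ⟨E, hE⟩ : ∃ E, E = ∫ x in closure Ω, ‖gradient v x‖ ^ 2 := ⟨_, rfl⟩
    rw [← hE]
    have hE0 : 0 ≤ E := hE ▸ integral_nonneg fun x => by positivity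
    have hQ : ∫⁻ t in Icc 0 (3 * m), ∫⁻ y in Icc 0 σ, H t y ^ 2
        ≤ ENNReal.ofReal (2 / r * E) := by
      rw [hHdef]
      refine (lintegral_rectangle_le A g d (abs_pos.1 hδ) (hG.pow_const 2)
        isClosed_closure.measurableSet hmem).trans ?_
      rw [hE, hv, lintegral_enorm_gradient_sq hT hΩ hU, ← hv, ← hE,
        ← ENNReal.ofReal_mul (abs_nonneg _)]
      refine ENNReal.ofReal_le_ofReal (mul_le_mul_of_nonneg_right ?_ hE0)
      -- The Jacobian is at least `r / 2` because `z` was chosen away from the line.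
      rw [abs_inv, inv_le_comm₀ hδ (by positivity), inv_div]
      exact hz
    have hq : 0 ≤ 2 / r * E := mul_nonneg (by positivity) hE0
    have h7 := pow_mul_le_of_lintegral_le hm hσ hq hV hQ
    calc m ^ 4 = D * (m ^ 3 * σ) := by linear_combination (-m ^ 3) * hDσ
      _ ≤ D * (432 * (2 / r * E)) := by gcongr
      _ = _ := by ring
  · rw [Measure.volume_eq_prod] at hdiffae
    filter_upwards [Measure.ae_ae_of_ae_prod hdiffae] with t ht htI y hy
    have h1 := enorm_sub_le_lintegral_gradient hT hΩ hU hv (A := A + t • g) (d := d) hy.1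
      (fun y' hy' => hmem t htI y' ⟨hy'.1, hy'.2.trans hy.2⟩)
      (by filter_upwards [ht] with y' h hy'
          exact h (hmem t htI y' ⟨hy'.1, hy'.2.trans hy.2⟩))
    refine h1.trans ?_
    rw [← ofReal_norm (x := d)]
    rw [hHdef]
    gcongr
    exact hy.2
  · have h1 := (Measure.measurePreserving_swap (μ := (volume : Measure ℝ))
      (ν := (volume : Measure ℝ))).quasiMeasurePreserving.ae hdiffae
    filter_upwards [Measure.ae_ae_of_ae_prod h1] with y hy hyI a b ha hab hb
    have hcomm : ∀ t : ℝ, A + t • g + y • d = A + y • d + t • g := fun t => by abel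
    have h2 := enorm_sub_le_lintegral_gradient hT hΩ hU hv (A := A + y • d) (d := g) hab
      (fun t ht => by rw [← hcomm]; exact hmem t ⟨ha.trans ht.1, ht.2.trans hb⟩ y hyI)
      (by filter_upwards [hy] with t h ht
          rw [← hcomm]
          exact h (hmem t ⟨ha.trans ht.1, ht.2.trans hb⟩ y hyI))
    rw [← ofReal_norm (x := g), hg, ENNReal.ofReal_one, one_mul] at h2
    simp only [hHdef, hcomm]
    exact h2.trans (lintegral_mono_set (Icc_subset_Icc ha hb))
  · intro t ht
    simpa using hdiff t ht

/-! ### Pigeonhole for a covered segment -/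

section Subsegment

/-- A segment covered by finitely many triangles has a subsegment of proportional length in one of
them. -/
lemma exists_subsegment_in_body {F : Finset (Finset Plane)} (hF : F.Nonempty) {A g : Plane} {L : ℝ}
    (hL : 0 < L) (hcov : ∀ t ∈ Icc 0 L, A + t • g ∈ ⋃ s ∈ F, body s) :
    ∃ s ∈ F, ∃ a, 0 ≤ a ∧ a + L / F.card ≤ L ∧ A + a • g ∈ body s ∧
      A + (a + L / F.card) • g ∈ body s := by
  have hcard : (0 : ℝ) < F.card := by exact_mod_cast hF.card_pos
  set P : Finset Plane → Set ℝ := fun s => {t | A + t • g ∈ body s} ∩ Icc 0 L with hP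
  have hun : Icc 0 L = ⋃ s ∈ F, P s := by
    ext t
    constructor
    · intro ht
      obtain ⟨s, hs, hts⟩ := mem_iUnion₂.1 (hcov t ht)
      exact mem_biUnion hs ⟨hts, ht⟩
    · intro ht
      obtain ⟨s, -, hts⟩ := mem_iUnion₂.1 ht
      exact hts.2
  have h1 : L ≤ ∑ s ∈ F, volume.real (P s) := by
    calc L = volume.real (Icc 0 L) := by rw [Real.volume_real_Icc_of_le hL.le, sub_zero]
      _ = volume.real (⋃ s ∈ F, P s) := by rw [← hun]
      _ ≤ _ := measureReal_biUnion_finset_le _ _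
  -- Some triangle carries at least the average share of the length; by convexity its share is a
  -- single interval.
  have h2 : ∑ _s ∈ F, L / F.card ≤ ∑ s ∈ F, volume.real (P s) := by
    rw [Finset.sum_const, nsmul_eq_mul, mul_div_cancel₀ _ hcard.ne']
    exact h1
  obtain ⟨s, hs, hle⟩ := Finset.exists_le_of_sum_le hF h2
  have hpos : 0 < volume.real (P s) := (div_pos hL hcard).trans_le hle
  have hne : (P s).Nonempty := by
    by_contra h
    rw [not_nonempty_iff_eq_empty.1 h] at hpos
    simp at hpos
  obtain ⟨c, e, hce, hIcc⟩ := line_inter_body_eq_Icc hne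
  have hPs : P s = Icc c e := hIcc
  rw [hPs, Real.volume_real_Icc_of_le hce] at hle
  have hc : c ∈ P s := by rw [hPs]; exact left_mem_Icc.2 hce
  have hc' : c + L / F.card ∈ P s := by
    rw [hPs]
    exact ⟨le_add_of_nonneg_right (div_pos hL hcard).le, by linarith⟩
  exact ⟨s, hs, c, hc.2.1, hc'.2.2, hc.1, hc'.1⟩

end Subsegment

/-! ### Slope variation of a piecewise affine function -/

section PiecewiseAffine

/-- A piecewise affine function of one variable differs from an affine function by a function whose
Lipschitz constant is the total variation of the slope. -/
lemma abs_sub_le_of_slope_variation {N : ℕ} {t m : ℕ → ℝ} {w : ℝ → ℝ} {τ : ℝ}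
    (ht : ∀ i ≤ N, t i < t (i + 1))
    (hw : ∀ i ≤ N, ∀ x ∈ Icc (t i) (t (i + 1)), ∀ y ∈ Icc (t i) (t (i + 1)),
      w x - w y = m i * (x - y))
    (hτ : ∑ i ∈ Finset.Icc 1 N, |m i - m (i - 1)| ≤ τ) {x y : ℝ}
    (hx : t 0 ≤ x) (hxy : x ≤ y) (hy : y ≤ t (N + 1)) :
    |w y - w x - m 0 * (y - x)| ≤ τ * (y - x) := by
  have hsum : ∀ k, |m k - m 0| ≤ ∑ i ∈ Finset.Icc 1 k, |m i - m (i - 1)| := by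
    intro k
    induction k with
    | zero => simp
    | succ k ih =>
      rw [Finset.sum_Icc_succ_top (by omega), Nat.add_sub_cancel]
      have := abs_add_le (m (k + 1) - m k) (m k - m 0)
      rw [sub_add_sub_cancel] at this
      linarith
  have hslope : ∀ k ≤ N, |m k - m 0| ≤ τ := fun k hk =>
    (hsum k).trans ((Finset.sum_le_sum_of_subset_of_nonneg (Finset.Icc_subset_Icc_right hk)
      fun _ _ _ => abs_nonneg _).trans hτ)
  have hpiece : ∀ k ≤ N, ∀ x ∈ Icc (t k) (t (k + 1)), ∀ y ∈ Icc (t k) (t (k + 1)), x ≤ y →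
      |w y - w x - m 0 * (y - x)| ≤ τ * (y - x) := by
    intro k hk x hx y hy hxy
    rw [hw k hk y hy x hx, ← sub_mul, abs_mul, abs_of_nonneg (sub_nonneg.2 hxy)]
    exact mul_le_mul_of_nonneg_right (hslope k hk) (sub_nonneg.2 hxy)
  have hind : ∀ k ≤ N + 1, ∀ x y, t 0 ≤ x → x ≤ y → y ≤ t k →
      |w y - w x - m 0 * (y - x)| ≤ τ * (y - x) := by
    intro k
    induction k with
    | zero =>
      intro _ x y hx hxy hy
      have : x = y := le_antisymm hxy (hy.trans hx)
      simp [this]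
    | succ k ih =>
      intro hk x y hx hxy hy
      rcases le_total y (t k) with hyk | hyk
      · exact ih (by omega) x y hx hxy hyk
      rcases le_total (t k) x with hxk | hxk
      · exact hpiece k (by omega) x ⟨hxk, hxy.trans hy⟩ y ⟨hyk, hy⟩ hxy
      · have h1 := ih (by omega) x (t k) hx hxk le_rfl
        have h2 := hpiece k (by omega) (t k) ⟨le_rfl, (ht k (by omega)).le⟩ y ⟨hyk, hy⟩ hyk
        have h3 := abs_add_le (w y - w (t k) - m 0 * (y - t k)) (w (t k) - w x - m 0 * (t k - x))
        have h4 : w y - w (t k) - m 0 * (y - t k) + (w (t k) - w x - m 0 * (t k - x))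
            = w y - w x - m 0 * (y - x) := by ring
        rw [h4] at h3
        linarith
  exact hind (N + 1) le_rfl x y hx hxy hy

end PiecewiseAffine

/-! ### Directions and angles at a vertex of the band -/

section Vectors

lemma inner_plane (x y : Plane) : inner ℝ x y = x 0 * y 0 + x 1 * y 1 := by
  simp [PiLp.inner_apply, Fin.sum_univ_two, mul_comm]

/-- Two unit vectors in the half-plane of `g`, on different sides of the line spanned by `g`, make a
larger angle with each other than with `g`. -/
lemma inner_le_inner_of_opposite_sides {g n e₁ e₂ : Plane} (hg : ‖g‖ = 1) (h₁ : ‖e₁‖ = 1)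
    (h₂ : ‖e₂‖ = 1) (hn : inner ℝ n g = 0) (hn₁ : inner ℝ n e₁ < 0) (hn₂ : 0 < inner ℝ n e₂)
    (hg₁ : 0 ≤ inner ℝ e₁ g) (hg₂ : 0 ≤ inner ℝ e₂ g) :
    inner ℝ e₁ e₂ ≤ inner ℝ e₁ g ∧ inner ℝ e₁ e₂ ≤ inner ℝ e₂ g := by
  have b₁ : inner ℝ e₁ g ≤ 1 := by simpa [hg, h₁] using real_inner_le_norm e₁ g
  have b₂ : inner ℝ e₂ g ≤ 1 := by simpa [hg, h₂] using real_inner_le_norm e₂ g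
  have hg2 : g 0 ^ 2 + g 1 ^ 2 = 1 := by
    have := real_inner_self_eq_norm_sq g
    rw [hg, inner_plane] at this
    linarith
  have hdec : ∀ x : Plane, inner ℝ n x = (n 1 * g 0 - n 0 * g 1) * (g 0 * x 1 - g 1 * x 0) := by
    intro x
    rw [inner_plane] at hn ⊢
    linear_combination (-(n 0 * x 0 + n 1 * x 1)) * hg2 + (g 0 * x 0 + g 1 * x 1) * hn
  have hprod : (g 0 * e₁ 1 - g 1 * e₁ 0) * (g 0 * e₂ 1 - g 1 * e₂ 0) ≤ 0 := by
    rw [hdec] at hn₁ hn₂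
    by_contra! h
    have h3 := mul_neg_of_neg_of_pos hn₁ hn₂
    nlinarith [mul_nonneg (sq_nonneg (n 1 * g 0 - n 0 * g 1)) h.le]
  -- Expansion in the orthonormal frame of `g` and its normal. The normal part is nonpositive, and
  -- each factor of the tangential part lies in `[0, 1]`.
  have hid : inner ℝ e₁ e₂ = inner ℝ e₁ g * inner ℝ e₂ g
      + (g 0 * e₁ 1 - g 1 * e₁ 0) * (g 0 * e₂ 1 - g 1 * e₂ 0) := by
    simp only [inner_plane]
    linear_combination (-(e₁ 0 * e₂ 0 + e₁ 1 * e₂ 1)) * hg2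
  constructor <;> nlinarith

lemma norm_sub_sq_of_unit {x y : Plane} (hx : ‖x‖ = 1) (hy : ‖y‖ = 1) :
    ‖x - y‖ ^ 2 = 2 - 2 * inner ℝ x y := by
  rw [norm_sub_sq_real, hx, hy]; ring

/-- The jump of a directional derivative in terms of the gradients of three neighbouring affine
functions. -/
lemma abs_inner_sub_le {g e₁ e₂ a a₁ a₂ c : Plane} (ha₁ : inner ℝ a e₁ = inner ℝ a₁ e₁)
    (ha₂ : inner ℝ a e₂ = inner ℝ a₂ e₂) {δ : ℝ} (hδ : ‖e₂ - e₁‖ ≤ δ) (hδ₁ : ‖e₁ - g‖ ≤ δ)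
    (hδ₂ : ‖e₂ - g‖ ≤ δ) :
    |inner ℝ a₂ g - inner ℝ a₁ g| ≤ δ * (‖a - c‖ + ‖a₂ - c‖ + ‖a₁ - c‖) := by
  -- The vector `c` cancels, so it may later be the exact gradient at the common vertex.
  have hid : inner ℝ a₂ g - inner ℝ a₁ g = inner ℝ (a - c) (e₂ - e₁)
      - inner ℝ (a₂ - c) (e₂ - g) + inner ℝ (a₁ - c) (e₁ - g) := by
    simp only [inner_sub_left, inner_sub_right]
    rw [ha₁, ha₂]
    ring
  have hb : ∀ x y : Plane, ‖y‖ ≤ δ → |inner ℝ x y| ≤ δ * ‖x‖ := fun x y hy => by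
    rw [mul_comm]
    exact (abs_real_inner_le_norm x y).trans (mul_le_mul_of_nonneg_left hy (norm_nonneg x))
  have h1 := abs_le.1 (hb (a - c) _ hδ)
  have h2 := abs_le.1 (hb (a₂ - c) _ hδ₂)
  have h3 := abs_le.1 (hb (a₁ - c) _ hδ₁)
  rw [hid, abs_le]
  constructor <;> linarith [h1.1, h1.2, h2.1, h2.2, h3.1, h3.2]

/-- In a triangle, an angle which is not the largest is not obtuse. -/
lemma angle_le_pi_div_two_of_le {a b c : Plane} (hab : a ≠ b)
    (h : EuclideanGeometry.angle a b c ≤ EuclideanGeometry.angle b a c) :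
    EuclideanGeometry.angle a b c ≤ Real.pi / 2 := by
  have h1 := EuclideanGeometry.angle_add_angle_add_angle_eq_pi c hab.symm
  have h2 := EuclideanGeometry.angle_nonneg b c a
  rw [EuclideanGeometry.angle_comm c a b] at h1
  linarith

lemma inner_nonneg_of_angle_le {a b c : Plane}
    (h : EuclideanGeometry.angle a b c ≤ Real.pi / 2) : 0 ≤ inner ℝ (a - b) (c - b) := by
  have h1 := InnerProductGeometry.cos_angle_mul_norm_mul_norm (a - b) (c - b)
  rw [← h1]
  have h2 : 0 ≤ Real.cos (InnerProductGeometry.angle (a - b) (c - b)) :=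
    Real.cos_nonneg_of_neg_pi_div_two_le_of_le
      (by linarith [InnerProductGeometry.angle_nonneg (a - b) (c - b), Real.pi_pos]) h
  positivity

/-- If the largest angle of a triangle is at `p`, then it controls the distance of the unit vectors
from `q'` to `p` and from `p` to `q`. -/
lemma norm_sub_le_two_mul_sin {p q q' : Plane} (hq : q ≠ p) (hq' : q' ≠ p)
    (h1 : EuclideanGeometry.angle p q' q ≤ EuclideanGeometry.angle q' p q)
    (h2 : EuclideanGeometry.angle q' q p ≤ EuclideanGeometry.angle q' p q) :
    ‖‖q - p‖⁻¹ • (q - p) - ‖p - q'‖⁻¹ • (p - q')‖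
      ≤ 2 * Real.sin (Real.pi - EuclideanGeometry.angle q' p q) := by
  have hn : 0 < ‖q - p‖ := norm_pos_iff.2 (sub_ne_zero.2 hq)
  have hn' : 0 < ‖p - q'‖ := norm_pos_iff.2 (sub_ne_zero.2 hq'.symm)
  have hsum := EuclideanGeometry.angle_add_angle_add_angle_eq_pi q hq'
  rw [EuclideanGeometry.angle_comm q p q'] at hsum
  set θ := EuclideanGeometry.angle q' p q with hθ
  have hθ3 : Real.pi / 3 ≤ θ := by linarith
  have hθπ : θ ≤ Real.pi := EuclideanGeometry.angle_le_pi _ _ _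
  have hcos : Real.cos θ ≤ 1 / 2 := by
    rw [← Real.cos_pi_div_three]
    exact Real.cos_le_cos_of_nonneg_of_le_pi (by positivity) hθπ hθ3
  have hsin : 0 ≤ Real.sin θ := Real.sin_nonneg_of_nonneg_of_le_pi (by linarith [Real.pi_pos]) hθπ
  have hc : inner ℝ (‖q - p‖⁻¹ • (q - p)) (‖p - q'‖⁻¹ • (p - q')) = -Real.cos θ := by
    have h3 := InnerProductGeometry.cos_angle_mul_norm_mul_norm (q' - p) (q - p)
    have h4 : InnerProductGeometry.angle (q' - p) (q - p) = θ := rfl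
    rw [h4, norm_sub_rev q' p] at h3
    have h5 : inner ℝ (q - p) (p - q') = -inner ℝ (q' - p) (q - p) := by
      rw [← neg_sub q' p, inner_neg_right, real_inner_comm]
    rw [inner_smul_left, inner_smul_right, h5, ← h3]
    simp only [conj_trivial]
    field_simp
  have hu1 : ‖‖q - p‖⁻¹ • (q - p)‖ = 1 := by
    rw [norm_smul, norm_inv, norm_norm, inv_mul_cancel₀ hn.ne']
  have hu2 : ‖‖p - q'‖⁻¹ • (p - q')‖ = 1 := by
    rw [norm_smul, norm_inv, norm_norm, inv_mul_cancel₀ hn'.ne']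
  rw [Real.sin_pi_sub]
  refine (pow_le_pow_iff_left₀ (norm_nonneg _) (by positivity) two_ne_zero).1 ?_
  rw [norm_sub_sq_of_unit hu1 hu2, hc]
  have hs2 := Real.sin_sq_add_cos_sq θ
  -- The claim is `2 + 2 cos θ ≤ 4 sin² θ = 4 (1 - cos θ) (1 + cos θ)`, which holds since `cos θ ≤ 1
  -- / 2`: a largest angle is at least `π / 3`.
  nlinarith [Real.neg_one_le_cos θ]

end Vectors

lemma mem_tri {a b c x : Plane} : x ∈ tri a b c ↔ x = a ∨ x = b ∨ x = c := by
  simp [tri]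

/-! ### Geometry of a band and slopes along its edge -/

namespace Band

variable {T : Geometry.SimplicialComplex ℝ Plane} {Ω : Set Plane} {U : Plane → ℝ} (B : Band T)

/-- The coordinate of the point `p k` along the edge of the band. -/
noncomputable def abscissa (k : ℕ) : ℝ := inner ℝ (B.p k - B.p 0) B.g

lemma abscissa_zero : B.abscissa 0 = 0 := by simp [abscissa]

lemma p_succ_sub {i : ℕ} (hi : i ≤ B.N) :
    B.p (i + 1) = B.p i + (B.abscissa (i + 1) - B.abscissa i) • B.g ∧
      B.abscissa i < B.abscissa (i + 1) := by
  obtain ⟨l, hl, hp⟩ := B.straight i hi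
  have h1 : B.abscissa (i + 1) - B.abscissa i = l := by
    rw [abscissa, abscissa, ← inner_sub_left, sub_sub_sub_cancel_right, hp, add_sub_cancel_left,
      real_inner_smul_left, real_inner_self_eq_norm_sq, B.norm_g]
    ring
  exact ⟨by rw [h1, hp], by linarith⟩

lemma p_eq {k : ℕ} (hk : k ≤ B.N + 1) : B.p k = B.p 0 + B.abscissa k • B.g := by
  induction k with
  | zero => simp [abscissa_zero]
  | succ k ih =>
    rw [(B.p_succ_sub (by omega)).1, ih (by omega), sub_smul]
    abel

lemma abscissa_lt {i j : ℕ} (hij : i < j) (hj : j ≤ B.N + 1) : B.abscissa i < B.abscissa j := by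
  induction j with
  | zero => omega
  | succ j ih =>
    have h1 := (B.p_succ_sub (i := j) (by omega)).2
    rcases Nat.lt_succ_iff_lt_or_eq.1 hij with h | rfl
    · exact (ih h (by omega)).trans h1
    · exact h1

lemma eq_of_p_eq {i j : ℕ} (hi : i ≤ B.N + 1) (hj : j ≤ B.N + 1) (h : B.p i = B.p j) : i = j := by
  have h1 : B.abscissa i = B.abscissa j := by rw [abscissa, abscissa, h]
  rcases lt_trichotomy i j with h2 | h2 | h2
  · exact absurd h1 (B.abscissa_lt h2 hj).ne
  · exact h2
  · exact absurd h1 (B.abscissa_lt h2 hi).ne'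

lemma p_ne_q {i j : ℕ} (hi : i ≤ B.N + 1) (hj : j ≤ B.N) : B.p i ≠ B.q j := by
  obtain ⟨n, hn, hq⟩ := B.one_side
  intro h
  have h1 := hq j hj
  rw [← h, B.p_eq hi, add_sub_cancel_left, inner_smul_right, hn, mul_zero] at h1
  exact lt_irrefl _ h1

lemma L_eq : B.L = B.abscissa (B.N + 1) := by
  have h1 := B.abscissa_lt (Nat.succ_pos B.N) le_rfl
  rw [abscissa_zero] at h1
  rw [L, dist_comm, dist_eq_norm, B.p_eq le_rfl, add_sub_cancel_left, norm_smul, B.norm_g, mul_one,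
    Real.norm_eq_abs, abs_of_pos h1]

lemma L_pos : 0 < B.L := by
  have h1 := B.abscissa_lt (Nat.succ_pos B.N) le_rfl
  rw [abscissa_zero] at h1
  rwa [L_eq]

lemma K_mem_elements {i : ℕ} (hi : i ≤ B.N) : B.K i ∈ elements T := B.K_mem i hi

lemma Kt_mem_elements {i : ℕ} (hi : i ∈ Finset.Icc 1 B.N) : B.Kt i ∈ elements T := B.Kt_mem i hi

lemma elems_subset_elements : B.elems ⊆ elements T := by
  rintro s (⟨i, hi, rfl⟩ | ⟨i, hi, rfl⟩)
  · exact B.K_mem_elements hi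
  · exact B.Kt_mem_elements hi

/-- Equality of `K i` and `K j` puts `p i` among the vertices of `K j`, leaving `i = j` or `i = j +
1`. The symmetric statement rules out the second case. -/
lemma K_injOn : InjOn B.K (Iic B.N) := by
  have key : ∀ {i j}, i ≤ B.N → j ≤ B.N → B.K i = B.K j → i = j ∨ i = j + 1 := by
    intro i j hi hj h
    have h1 : B.p i ∈ B.K j := by rw [← h, K, mem_tri]; exact Or.inl rfl
    rw [K, mem_tri] at h1
    rcases h1 with h1 | h1 | h1
    · exact Or.inl (B.eq_of_p_eq (by omega) (by omega) h1)
    · exact Or.inr (B.eq_of_p_eq (by omega) (by omega) h1)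
    · exact absurd h1 (B.p_ne_q (by omega) hj)
  intro i hi j hj h
  have h1 := key hi hj h
  have h2 := key hj hi h.symm
  omega

lemma Kt_injOn : InjOn B.Kt (Finset.Icc 1 B.N) := by
  intro i hi j hj h
  have hi' := Finset.mem_Icc.1 hi
  have hj' := Finset.mem_Icc.1 hj
  have h1 : B.p i ∈ B.Kt j := by rw [← h, Kt, mem_tri]; exact Or.inl rfl
  rw [Kt, mem_tri] at h1
  rcases h1 with h1 | h1 | h1
  · exact B.eq_of_p_eq (by omega) (by omega) h1
  · exact absurd h1 (B.p_ne_q (by omega) (by omega))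
  · exact absurd h1 (B.p_ne_q (by omega) (by omega))

lemma mem_body_K {i : ℕ} (hi : i ≤ B.N) {x : ℝ}
    (hx : x ∈ Icc (B.abscissa i) (B.abscissa (i + 1))) : B.p 0 + x • B.g ∈ body (B.K i) := by
  have h0 : B.p i ∈ body (B.K i) := mem_body_of_mem (by simp [K, mem_tri])
  have h1 : B.p (i + 1) ∈ body (B.K i) := mem_body_of_mem (by simp [K, mem_tri])
  have hlt := (B.p_succ_sub hi).2
  rw [B.p_eq (by omega)] at h0 h1
  have h2 := (convex_body (B.K i)).segment_subset h0 h1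
  apply h2
  rw [segment_eq_image_lineMap]
  refine ⟨(x - B.abscissa i) / (B.abscissa (i + 1) - B.abscissa i),
    ⟨div_nonneg (by linarith [hx.1]) (by linarith),
      (div_le_one (by linarith)).2 (by linarith [hx.2])⟩, ?_⟩
  have h3 : (x - B.abscissa i) / (B.abscissa (i + 1) - B.abscissa i)
      * (B.abscissa (i + 1) - B.abscissa i) = x - B.abscissa i :=
    div_mul_cancel₀ _ (by linarith)
  rw [AffineMap.lineMap_apply, vsub_eq_sub, vadd_eq_add, add_sub_add_left_eq_sub, ← sub_smul,
    smul_smul, h3]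
  module

lemma exists_mem_body_K {x : ℝ} (hx : x ∈ Icc 0 B.L) :
    ∃ i ≤ B.N, x ∈ Icc (B.abscissa i) (B.abscissa (i + 1)) := by
  have key : ∀ k ≤ B.N + 1, B.abscissa k < x ∨ x = 0 ∨
      ∃ i < k, x ∈ Icc (B.abscissa i) (B.abscissa (i + 1)) := by
    intro k
    induction k with
    | zero =>
      intro _
      rw [abscissa_zero]
      rcases hx.1.lt_or_eq with h | h
      · exact Or.inl h
      · exact Or.inr (Or.inl h.symm)
    | succ k ih =>
      intro hk
      rcases ih (by omega) with h | h | ⟨i, hi, h⟩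
      · rcases lt_or_ge (B.abscissa (k + 1)) x with h' | h'
        · exact Or.inl h'
        · exact Or.inr (Or.inr ⟨k, by omega, h.le, h'⟩)
      · exact Or.inr (Or.inl h)
      · exact Or.inr (Or.inr ⟨i, by omega, h⟩)
  rcases key (B.N + 1) le_rfl with h | h | ⟨i, hi, h⟩
  · exact absurd (B.L_eq ▸ hx.2) (not_le.2 h)
  · refine ⟨0, Nat.zero_le _, ?_, ?_⟩
    · rw [abscissa_zero, h]
    · rw [h, ← B.abscissa_zero]
      exact (B.abscissa_lt (Nat.lt_succ_self 0) (by omega)).le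
  · exact ⟨i, by omega, h⟩

lemma edge_subset_closure (hT : IsTriangulation T Ω) {x : ℝ} (hx : x ∈ Icc 0 B.L) :
    B.p 0 + x • B.g ∈ closure Ω := by
  obtain ⟨i, hi, hxi⟩ := B.exists_mem_body_K hx
  exact body_subset_closure hT (B.K_mem_elements hi) (B.mem_body_K hi hxi)

lemma region_subset_closure (hT : IsTriangulation T Ω) : B.region ⊆ closure Ω :=
  iUnion₂_subset fun _ hs => body_subset_closure hT (B.elems_subset_elements hs)

open Classical in
/-- The gradient of `U` on the element `K i` of the band. -/
noncomputable def gradK (hU : U ∈ X T) (i : ℕ) : Plane :=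
  if hi : i ≤ B.N then elementGradient U hU ⟨B.K i, B.K_mem_elements hi⟩ else 0

/-- The derivative of `U` along the edge of the band, on the element `K i`. -/
noncomputable def slope (hU : U ∈ X T) (i : ℕ) : ℝ := inner ℝ (B.gradK hU i) B.g

lemma sub_eq_slope_mul (hU : U ∈ X T) {i : ℕ} (hi : i ≤ B.N) {x y : ℝ}
    (hx : x ∈ Icc (B.abscissa i) (B.abscissa (i + 1)))
    (hy : y ∈ Icc (B.abscissa i) (B.abscissa (i + 1))) :
    U (B.p 0 + x • B.g) - U (B.p 0 + y • B.g) = B.slope hU i * (x - y) := by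
  rw [sub_eq_inner_elementGradient hU ⟨B.K i, B.K_mem_elements hi⟩ (B.mem_body_K hi hx)
    (B.mem_body_K hi hy), add_sub_add_left_eq_sub, ← sub_smul, real_inner_smul_right, slope, gradK,
    dif_pos hi]
  ring

/-- The jump of the derivative along the edge is controlled by the gradients on the three elements
which meet at `p i`. -/
lemma abs_slope_sub_le (hU : U ∈ X T) {i : ℕ} (hi : i ∈ Finset.Icc 1 B.N) (c : Plane) :
    |B.slope hU i - B.slope hU (i - 1)| ≤ 2 * Real.sin (Real.pi - B.αt i) *
      (‖elementGradient U hU ⟨B.Kt i, B.Kt_mem_elements hi⟩ - c‖ + ‖B.gradK hU i - c‖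
        + ‖B.gradK hU (i - 1) - c‖) := by
  obtain ⟨n, hn, hnq⟩ := B.one_side
  obtain ⟨hi1, hiN⟩ := Finset.mem_Icc.1 hi
  have hi' : i - 1 ≤ B.N := by omega
  have hii : i - 1 + 1 = i := by omega
  have hpq : B.p i ≠ B.q i := B.p_ne_q (by omega) hiN
  have hpq' : B.p i ≠ B.q (i - 1) := B.p_ne_q (by omega) hi'
  have hn1 : 0 < ‖B.q i - B.p i‖ := norm_pos_iff.2 (sub_ne_zero.2 hpq.symm)
  have hn2 : 0 < ‖B.p i - B.q (i - 1)‖ := norm_pos_iff.2 (sub_ne_zero.2 hpq')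
  have hδ := norm_sub_le_two_mul_sin hpq.symm hpq'.symm (B.Kt_maxAngle i hi).1
    (B.Kt_maxAngle i hi).2
  obtain ⟨e₂, he₂⟩ : ∃ e, e = ‖B.q i - B.p i‖⁻¹ • (B.q i - B.p i) := ⟨_, rfl⟩
  obtain ⟨e₁, he₁⟩ : ∃ e, e = ‖B.p i - B.q (i - 1)‖⁻¹ • (B.p i - B.q (i - 1)) := ⟨_, rfl⟩
  rw [← he₁, ← he₂] at hδ
  have hu2 : ‖e₂‖ = 1 := by
    rw [he₂, norm_smul, norm_inv, norm_norm, inv_mul_cancel₀ hn1.ne']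
  have hu1 : ‖e₁‖ = 1 := by
    rw [he₁, norm_smul, norm_inv, norm_norm, inv_mul_cancel₀ hn2.ne']
  have hnp : inner ℝ n (B.p i) = inner ℝ n (B.p 0) := by
    rw [B.p_eq (by omega), inner_add_right, inner_smul_right, hn, mul_zero, add_zero]
  have hne2 : 0 < inner ℝ n e₂ := by
    have h1 := hnq i hiN
    rw [inner_sub_right, ← hnp, ← inner_sub_right] at h1
    rw [he₂, inner_smul_right]
    positivity
  have hne1 : inner ℝ n e₁ < 0 := by
    have h1 := hnq (i - 1) hi'
    rw [inner_sub_right, ← hnp, ← inner_sub_right, ← neg_sub, inner_neg_right] at h1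
    rw [he₁, inner_smul_right]
    exact mul_neg_of_pos_of_neg (inv_pos.2 hn2) (by linarith)
  -- The largest angle of `K i` is at `q i`, so its angle at `p i` is not obtuse. The same argument
  -- in `K (i - 1)` handles `e₁`.
  have hg2 : 0 ≤ inner ℝ e₂ B.g := by
    have h1 := inner_nonneg_of_angle_le
      (angle_le_pi_div_two_of_le hpq.symm (B.K_maxAngle i hiN).1)
    obtain ⟨hp, hlt⟩ := B.p_succ_sub hiN
    rw [hp, add_sub_cancel_left, real_inner_smul_right] at h1
    rw [he₂, real_inner_smul_left]
    exact mul_nonneg (inv_pos.2 hn1).le (nonneg_of_mul_nonneg_right h1 (sub_pos.2 hlt))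
  have hg1 : 0 ≤ inner ℝ e₁ B.g := by
    have h0 := (B.K_maxAngle (i - 1) hi').2
    rw [hii, EuclideanGeometry.angle_comm, EuclideanGeometry.angle_comm _ (B.q (i - 1))] at h0
    have h1 := inner_nonneg_of_angle_le (angle_le_pi_div_two_of_le hpq'.symm h0)
    obtain ⟨hp, hlt⟩ := B.p_succ_sub hi'
    rw [hii] at hp hlt
    have h2 : B.p (i - 1) - B.p i = -((B.abscissa i - B.abscissa (i - 1)) • B.g) := by
      rw [hp]; abel
    rw [h2, inner_neg_right, ← inner_neg_left, neg_sub, real_inner_smul_right] at h1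
    rw [he₁, real_inner_smul_left]
    exact mul_nonneg (inv_pos.2 hn2).le (nonneg_of_mul_nonneg_right h1 (sub_pos.2 hlt))
  obtain ⟨hle1, hle2⟩ := inner_le_inner_of_opposite_sides B.norm_g hu1 hu2 hn hne1 hne2 hg1 hg2
  -- For unit vectors a larger inner product means a smaller distance, so `e₁` and `e₂` are no
  -- farther from `g` than from each other.
  have hsq : ∀ e : Plane, ‖e‖ = 1 → inner ℝ e₁ e₂ ≤ inner ℝ e B.g → ‖e - B.g‖ ≤ ‖e₂ - e₁‖ := by
    intro e he hle
    refine (pow_le_pow_iff_left₀ (norm_nonneg _) (norm_nonneg _) two_ne_zero).1 ?_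
    rw [norm_sub_sq_of_unit he B.norm_g, norm_sub_sq_of_unit hu2 hu1, real_inner_comm e₁ e₂]
    linarith
  have hKt_p : B.p i ∈ body (B.Kt i) := mem_body_of_mem (by simp [Kt, mem_tri])
  have hKt_q : B.q i ∈ body (B.Kt i) := mem_body_of_mem (by simp [Kt, mem_tri])
  have hKt_q' : B.q (i - 1) ∈ body (B.Kt i) := mem_body_of_mem (by simp [Kt, mem_tri])
  have hK_p : B.p i ∈ body (B.K i) := mem_body_of_mem (by simp [K, mem_tri])
  have hK_q : B.q i ∈ body (B.K i) := mem_body_of_mem (by simp [K, mem_tri])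
  have hK'_p : B.p i ∈ body (B.K (i - 1)) := mem_body_of_mem (by simp [K, mem_tri, hii])
  have hK'_q : B.q (i - 1) ∈ body (B.K (i - 1)) := mem_body_of_mem (by simp [K, mem_tri])
  -- The two remaining goals say that the gradients on neighbouring elements agree along the shared
  -- edge: both give the increment of `U` between its endpoints.
  refine abs_inner_sub_le (e₁ := e₁) (e₂ := e₂) ?_ ?_ hδ ((hsq e₁ hu1 hle1).trans hδ)
    ((hsq e₂ hu2 hle2).trans hδ)
  · rw [he₁, inner_smul_right, inner_smul_right, gradK, dif_pos hi',
      ← sub_eq_inner_elementGradient hU ⟨B.Kt i, B.Kt_mem_elements hi⟩ hKt_p hKt_q',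
      ← sub_eq_inner_elementGradient hU ⟨B.K (i - 1), B.K_mem_elements hi'⟩ hK'_p hK'_q]
  · rw [he₂, inner_smul_right, inner_smul_right, gradK, dif_pos hiN,
      ← sub_eq_inner_elementGradient hU ⟨B.Kt i, B.Kt_mem_elements hi⟩ hKt_q hKt_p,
      ← sub_eq_inner_elementGradient hU ⟨B.K i, B.K_mem_elements hiN⟩ hK_q hK_p]

end Band

/-! ### Slope variation versus energy -/

/-- All geometric data entering the constants come from a cover fixed before the triangulation, with
one inradius bound `r` for its triangles. -/
lemma IsPolygonalDomain.exists_constants {Ω : Set Plane} (hΩ : IsPolygonalDomain Ω) :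
    ∃ (F : Finset (Finset Plane)) (r D : ℝ), F.Nonempty ∧ 0 < r ∧ 0 < D ∧
      closure Ω = ⋃ s ∈ F, body s ∧ (∀ s ∈ F, ∃ z, Metric.ball z r ⊆ body s) ∧
      ∀ x ∈ closure Ω, ∀ y ∈ closure Ω, dist x y ≤ D := by
  obtain ⟨F, hF, hcl⟩ := hΩ.polygonal
  have hne : F.Nonempty := by
    obtain ⟨x, hx⟩ := hΩ.isConnected.nonempty
    have h1 := subset_closure hx
    rw [hcl] at h1
    obtain ⟨s, hs, -⟩ := mem_iUnion₂.1 h1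
    exact ⟨s, hs⟩
  have hball : ∀ s ∈ F, ∃ z, ∃ r > 0, Metric.ball z r ⊆ body s := fun s hs =>
    exists_ball_subset_body (hF s hs).1 (hF s hs).2
  choose! z ρ hρ hsub using hball
  refine ⟨F, F.inf' hne ρ, Metric.diam (closure Ω) + 1, hne, (Finset.lt_inf'_iff hne).2 hρ,
    by positivity, hcl, fun s hs => ⟨z s, (Metric.ball_subset_ball (Finset.inf'_le ρ hs)).trans
      (hsub s hs)⟩, fun x hx y hy => ?_⟩
  have := Metric.dist_le_diam_of_mem hΩ.isCompact_closure.isBounded hx hy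
  linarith

lemma uExact_second_difference {g : Plane} (hg : ‖g‖ = 1) (A : Plane) (t m : ℝ) :
    uExact (A + (t + 2 * m) • g) - 2 * uExact (A + (t + m) • g) + uExact (A + t • g)
      = 2 * m ^ 2 := by
  have h : ∀ x : ℝ, uExact (A + x • g) = ‖A‖ ^ 2 + 2 * (x * inner ℝ A g) + x ^ 2 := fun x => by
    rw [uExact_eq, norm_add_sq_real, real_inner_smul_right, norm_smul, hg, Real.norm_eq_abs,
      mul_one, sq_abs]
  rw [h, h, h]
  ring

variable {T : Geometry.SimplicialComplex ℝ Plane} {Ω : Set Plane} {U : Plane → ℝ}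

/-- Either the derivative of `U` along the edge of a band varies proportionally to the length of the
edge, or the energy of the error is bounded from below by the fourth power of this length. -/
lemma Band.length_le_variation_or (B : Band T) (hT : IsTriangulation T Ω) (hΩ : IsOpen Ω)
    (hU : U ∈ X T) {F : Finset (Finset Plane)} (hF : F.Nonempty)
    (hcl : closure Ω = ⋃ s ∈ F, body s) {r D : ℝ} (hr : 0 < r)
    (hball : ∀ s ∈ F, ∃ z, Metric.ball z r ⊆ body s) (hD : 0 < D)
    (hdist : ∀ x ∈ closure Ω, ∀ y ∈ closure Ω, dist x y ≤ D) :
    B.L ≤ 12 * F.card * ∑ i ∈ Finset.Icc 1 B.N, |B.slope hU i - B.slope hU (i - 1)| ∨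
      (B.L / (6 * F.card)) ^ 4 ≤ 864 * (D / r) *
        ∫ x in closure Ω, ‖gradient (fun x => uExact x - U x) x‖ ^ 2 := by
  have hcard : (0 : ℝ) < F.card := by exact_mod_cast hF.card_pos
  obtain ⟨τ, hτ⟩ : ∃ τ, τ = ∑ i ∈ Finset.Icc 1 B.N, |B.slope hU i - B.slope hU (i - 1)| :=
    ⟨_, rfl⟩
  obtain ⟨m, hm⟩ : ∃ m, m = B.L / (6 * F.card) := ⟨_, rfl⟩
  have hm0 : 0 < m := by
    rw [hm]
    exact div_pos B.L_pos (mul_pos (by norm_num) hcard)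
  have hLm : B.L = 6 * F.card * m := by
    rw [hm, mul_div_cancel₀ _ (mul_pos (by norm_num) hcard).ne']
  have h6m : B.L / F.card = 6 * m := by rw [hLm, div_eq_iff hcard.ne']; ring
  rw [← hτ, ← hm]
  -- Below this threshold the second difference of `U` is at most `2 * τ * m < m²`, while that of
  -- `u` is `2 * m²`, so at least `m²` is left for the error.
  by_cases hle : m / 2 ≤ τ
  · left
    rw [hLm]
    nlinarith
  right
  obtain ⟨s, hs, a, ha0, haL, hsa, hsa'⟩ := exists_subsegment_in_body hF (A := B.p 0) (g := B.g)
    B.L_pos fun t ht => hcl ▸ B.edge_subset_closure hT ht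
  rw [h6m] at haL hsa'
  obtain ⟨z, hz⟩ := hball s hs
  have hsub : body s ⊆ closure Ω := by
    rw [hcl]
    exact subset_biUnion_of_mem (u := body) hs
  have hpt : ∀ t : ℝ, B.p 0 + a • B.g + t • B.g = B.p 0 + (a + t) • B.g := fun t => by module
  refine pow_four_le_energy_of_second_difference hT hΩ hU rfl hsub hr hz hD hdist
    (A := B.p 0 + a • B.g) B.norm_g hm0 hsa (by rw [hpt]; exact hsa') fun t ht => ?_
  have hu := uExact_second_difference B.norm_g (B.p 0 + a • B.g) t m
  have hvar : ∀ x y, 0 ≤ x → x ≤ y → y ≤ 6 * m →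
      |U (B.p 0 + (a + y) • B.g) - U (B.p 0 + (a + x) • B.g) - B.slope hU 0 * (y - x)|
        ≤ τ * (y - x) := by
    intro x y hx hxy hy
    have := abs_sub_le_of_slope_variation (w := fun x => U (B.p 0 + x • B.g))
      (fun i hi => (B.p_succ_sub hi).2)
      (fun i hi x hx y hy => B.sub_eq_slope_mul hU hi hx hy) hτ.ge (x := a + x) (y := a + y)
      (by rw [B.abscissa_zero]; linarith) (by linarith) (by rw [← B.L_eq]; linarith)
    simpa only [add_sub_add_left_eq_sub] using this
  have h1 := hvar t (t + m) ht.1 (by linarith) (by linarith [ht.2])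
  have h2 := hvar (t + m) (t + 2 * m) (by linarith [ht.1]) (by linarith) (by linarith [ht.2])
  simp only [hpt] at hu ⊢
  rw [not_le] at hle
  have h1' := abs_le.1 h1
  have h2' := abs_le.1 h2
  refine le_trans ?_ (le_abs_self _)
  nlinarith [h1'.1, h1'.2, h2'.1, h2'.2, mul_lt_mul_of_pos_right hle hm0]

/-! ### Weighted jumps and summation over bands -/

/-- The gradient of `U` is constant on the element and `∇u = 2x` varies by at most `2h` there, so
the gradient error at the single point `P` is controlled by its mean square. -/
lemma area_mul_normSq_le (hT : IsTriangulation T Ω) (hΩ : IsOpen Ω) (hU : U ∈ X T)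
    (s : elements T) {P : Plane} (hP : P ∈ body s.1) {h : ℝ} (hh : Metric.diam (body s.1) ≤ h) :
    area s.1 * ‖elementGradient U hU s - (2 : ℝ) • P‖ ^ 2 ≤
      ∫ x in body s.1, (2 * ‖gradient (fun x => uExact x - U x) x‖ ^ 2 + 8 * h ^ 2) := by
  have hint := (integrableOn_normSq_gradient hT hΩ hU).mono_set (body_subset_closure hT s.2)
  have hfin : volume (body s.1) ≠ ⊤ := (isCompact_body s.1).measure_lt_top.ne
  rw [area, ← smul_eq_mul, ← setIntegral_const]
  refine integral_mono_ae (integrableOn_const hfin)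
    ((hint.const_mul 2).add (integrableOn_const hfin)) ?_
  filter_upwards [normSq_gradient_ae_eq hU s,
    ae_restrict_mem (isClosed_body s.1).measurableSet] with x hx hxs
  rw [hx]
  have h1 : ‖x - P‖ ≤ h := by
    rw [← dist_eq_norm]
    exact (Metric.dist_le_diam_of_mem (isCompact_body s.1).isBounded hxs hP).trans hh
  have h2 : ‖elementGradient U hU s - (2 : ℝ) • P‖
      ≤ ‖(2 : ℝ) • x - elementGradient U hU s‖ + 2 * h := by
    have h3 : elementGradient U hU s - (2 : ℝ) • P
        = -((2 : ℝ) • x - elementGradient U hU s) + (2 : ℝ) • (x - P) := by module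
    rw [h3]
    refine (norm_add_le _ _).trans ?_
    rw [norm_neg, norm_smul, Real.norm_ofNat]
    linarith
  have h4 := pow_le_pow_left₀ (norm_nonneg _) h2 2
  nlinarith [sq_nonneg (‖(2 : ℝ) • x - elementGradient U hU s‖ - 2 * h)]

/-- Integrals over distinct elements of disjoint bands add up. -/
lemma sum_bands_setIntegral_le {NB : ℕ} {B : Fin NB → Band T}
    (hB : ∀ b b', b ≠ b' → Disjoint (B b).elems (B b').elems) {k : Fin NB → ℕ → Finset Plane}
    (hk : ∀ b, ∀ i ∈ Finset.Icc 1 (B b).N, k b i ∈ (B b).elems)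
    (hinj : ∀ b, InjOn (k b) (Finset.Icc 1 (B b).N)) {f : Plane → ℝ} (hf : ∀ x, 0 ≤ f x)
    {S : Set Plane} (hS : ⋃ b, (B b).region ⊆ S) (hfS : IntegrableOn f S) :
    ∑ b, ∑ i ∈ Finset.Icc 1 (B b).N, ∫ x in body (k b i), f x ≤ ∫ x in S, f x := by
  classical
  have hmem : ∀ z ∈ Finset.univ.sigma (fun b => Finset.Icc 1 (B b).N), k z.1 z.2 ∈ (B z.1).elems :=
    fun z hz => hk z.1 z.2 (Finset.mem_sigma.1 hz).2
  rw [Finset.sum_sigma' Finset.univ (fun b => Finset.Icc 1 (B b).N)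
    (fun b i => ∫ x in body (k b i), f x)]
  rw [← Finset.sum_image (f := fun s => ∫ x in body s, f x)
    (g := fun z : (_ : Fin NB) × ℕ => k z.1 z.2)]
  · refine sum_setIntegral_body_le (T := T) hf hfS ?_ ?_
    · intro s hs
      obtain ⟨z, hz, rfl⟩ := Finset.mem_image.1 hs
      exact (B z.1).elems_subset_elements (hmem z hz)
    · intro s hs
      obtain ⟨z, hz, rfl⟩ := Finset.mem_image.1 hs
      exact (subset_biUnion_of_mem (u := body) (hmem z hz)).trans
        ((subset_iUnion (fun b => (B b).region) z.1).trans hS)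
  · rintro ⟨b, i⟩ hz ⟨b', i'⟩ hz' h
    simp only at h
    have hbb : b = b' := by
      by_contra hne
      exact (disjoint_left.1 (hB b b' hne)) (hmem _ hz) (by simp only; rw [h]; exact hmem _ hz')
    subst hbb
    have hii : i = i' := hinj b (Finset.mem_sigma.1 hz).2 (Finset.mem_sigma.1 hz').2 h
    rw [hii]

/-- The jump of the derivative along the edge of a band at `p i`, weighted as in the lower bound of
the error, is controlled by the error on the elements which meet at `p i`. -/
lemma Band.weighted_jump_sq_le (B : Band T) (hT : IsTriangulation T Ω) (hΩ : IsOpen Ω)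
    (hU : U ∈ X T) {h : ℝ} (hh : ∀ s ∈ elements T, Metric.diam (body s) ≤ h) {CK : ℝ}
    (hCK : 0 ≤ CK) {i : ℕ} (hi : i ∈ Finset.Icc 1 B.N) (hK : area (B.Kt i) ≤ CK * area (B.K i))
    (hK' : area (B.Kt i) ≤ CK * area (B.K (i - 1))) {f : Plane → ℝ}
    (hf : f = fun x => 2 * ‖gradient (fun x => uExact x - U x) x‖ ^ 2 + 8 * h ^ 2) :
    1 / Real.sin (Real.pi - B.αt i) ^ 2 * area (B.Kt i)
        * (B.slope hU i - B.slope hU (i - 1)) ^ 2 ≤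
      12 * ((∫ x in body (B.Kt i), f x) + CK * (∫ x in body (B.K i), f x)
        + CK * ∫ x in body (B.K (i - 1)), f x) := by
  obtain ⟨hi1, hiN⟩ := Finset.mem_Icc.1 hi
  have hi' : i - 1 ≤ B.N := by omega
  have hii : i - 1 + 1 = i := by omega
  have e0 := area_mul_normSq_le hT hΩ hU ⟨B.Kt i, B.Kt_mem_elements hi⟩ (P := B.p i)
    (mem_body_of_mem (by simp [Kt, mem_tri])) (hh _ (B.Kt_mem_elements hi))
  have e1 := area_mul_normSq_le hT hΩ hU ⟨B.K i, B.K_mem_elements hiN⟩ (P := B.p i)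
    (mem_body_of_mem (by simp [K, mem_tri])) (hh _ (B.K_mem_elements hiN))
  have e2 := area_mul_normSq_le hT hΩ hU ⟨B.K (i - 1), B.K_mem_elements hi'⟩ (P := B.p i)
    (mem_body_of_mem (by simp [K, mem_tri, hii])) (hh _ (B.K_mem_elements hi'))
  have hj := B.abs_slope_sub_le hU hi ((2 : ℝ) • B.p i)
  rw [gradK, gradK, dif_pos hiN, dif_pos hi'] at hj
  simp only [← hf] at e0 e1 e2
  generalize ‖elementGradient U hU ⟨B.Kt i, B.Kt_mem_elements hi⟩ - (2 : ℝ) • B.p i‖ = a₀ at *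
  generalize ‖elementGradient U hU ⟨B.K i, B.K_mem_elements hiN⟩ - (2 : ℝ) • B.p i‖ = a₁ at *
  generalize ‖elementGradient U hU ⟨B.K (i - 1), B.K_mem_elements hi'⟩ - (2 : ℝ) • B.p i‖ = a₂ at *
  generalize B.slope hU i - B.slope hU (i - 1) = J at *
  generalize Real.sin (Real.pi - B.αt i) = σ at *
  have ha : 0 ≤ area (B.Kt i) := measureReal_nonneg
  -- The constant is `2² * 3`: the factor 2 in the jump bound squared, and Cauchy-Schwarz for three
  -- terms.
  have hJ : 1 / σ ^ 2 * J ^ 2 ≤ 12 * (a₀ ^ 2 + a₁ ^ 2 + a₂ ^ 2) := by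
    have h1 : J ^ 2 ≤ σ ^ 2 * (12 * (a₀ ^ 2 + a₁ ^ 2 + a₂ ^ 2)) := by
      have h2 : J ^ 2 ≤ (2 * σ * (a₀ + a₁ + a₂)) ^ 2 :=
        sq_le_sq' (by linarith [neg_le_of_abs_le hj]) (le_of_abs_le hj)
      have h3 : (a₀ + a₁ + a₂) ^ 2 ≤ 3 * (a₀ ^ 2 + a₁ ^ 2 + a₂ ^ 2) := by
        nlinarith [sq_nonneg (a₀ - a₁), sq_nonneg (a₀ - a₂), sq_nonneg (a₁ - a₂)]
      nlinarith [mul_le_mul_of_nonneg_left h3 (sq_nonneg σ)]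
    -- For `σ = 0` the convention `1 / 0 = 0` makes the left side vanish, so positivity of the sine
    -- need not be proved.
    rcases eq_or_ne σ 0 with h0 | h0
    · rw [h0]
      simp only [ne_eq, OfNat.ofNat_ne_zero, not_false_eq_true, zero_pow, div_zero, zero_mul]
      positivity
    · rw [one_div_mul_eq_div, div_le_iff₀ (by positivity)]
      linarith
  have h1 : area (B.Kt i) * a₁ ^ 2 ≤ CK * ∫ x in body (B.K i), f x :=
    (mul_le_mul_of_nonneg_right hK (sq_nonneg _)).trans
      (by rw [mul_assoc]; exact mul_le_mul_of_nonneg_left e1 hCK)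
  have h2 : area (B.Kt i) * a₂ ^ 2 ≤ CK * ∫ x in body (B.K (i - 1)), f x :=
    (mul_le_mul_of_nonneg_right hK' (sq_nonneg _)).trans
      (by rw [mul_assoc]; exact mul_le_mul_of_nonneg_left e2 hCK)
  calc 1 / σ ^ 2 * area (B.Kt i) * J ^ 2 = area (B.Kt i) * (1 / σ ^ 2 * J ^ 2) := by ring
    _ ≤ area (B.Kt i) * (12 * (a₀ ^ 2 + a₁ ^ 2 + a₂ ^ 2)) := by gcongr
    _ ≤ _ := by linarith

/-- The contribution of a band to the lower bound of the error, in terms of the jumps of the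
derivative along its edge. -/
lemma Band.minOver_mul_le (B : Band T) (hU : U ∈ X T) {κ : ℝ}
    (hL : B.L ≤ κ * ∑ i ∈ Finset.Icc 1 B.N, |B.slope hU i - B.slope hU (i - 1)|) :
    B.minOver (fun i => 1 / Real.sin (Real.pi - B.αt i) ^ 2) *
      B.minOver (fun i => area (B.Kt i)) * B.L ^ 2 / (B.N : ℝ) ≤
      κ ^ 2 * ∑ i ∈ Finset.Icc 1 B.N, 1 / Real.sin (Real.pi - B.αt i) ^ 2 * area (B.Kt i)
        * (B.slope hU i - B.slope hU (i - 1)) ^ 2 := by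
  have hN : (0 : ℝ) < B.N := by exact_mod_cast B.one_le_N
  set a := B.minOver (fun i => 1 / Real.sin (Real.pi - B.αt i) ^ 2) with ha
  set e := B.minOver (fun i => area (B.Kt i)) with he
  have ha0 : 0 ≤ a := (Finset.le_inf'_iff _ _).2 fun i _ => by positivity
  have he0 : 0 ≤ e := (Finset.le_inf'_iff _ _).2 fun i _ => measureReal_nonneg
  have hsq : B.L ^ 2 ≤ κ ^ 2 * (B.N *
      ∑ i ∈ Finset.Icc 1 B.N, (B.slope hU i - B.slope hU (i - 1)) ^ 2) := by
    refine (pow_le_pow_left₀ B.L_pos.le hL 2).trans ?_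
    rw [mul_pow]
    refine mul_le_mul_of_nonneg_left ?_ (sq_nonneg _)
    have := sq_sum_le_card_mul_sum_sq (s := Finset.Icc 1 B.N)
      (f := fun i => |B.slope hU i - B.slope hU (i - 1)|)
    simpa [sq_abs] using this
  calc a * e * B.L ^ 2 / B.N
      ≤ a * e * (κ ^ 2 * (B.N *
        ∑ i ∈ Finset.Icc 1 B.N, (B.slope hU i - B.slope hU (i - 1)) ^ 2)) / B.N := by gcongr
    _ = κ ^ 2 * ∑ i ∈ Finset.Icc 1 B.N, a * e * (B.slope hU i - B.slope hU (i - 1)) ^ 2 := by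
      rw [← Finset.mul_sum]
      field_simp
    _ ≤ _ := by
      gcongr with i hi
      · exact Finset.inf'_le (fun i => 1 / Real.sin (Real.pi - B.αt i) ^ 2) hi
      · exact Finset.inf'_le (fun i => area (B.Kt i)) hi

lemma setIntegral_closure_eq (hT : IsTriangulation T Ω) (hΩ : IsPolygonalDomain Ω)
    (f : Plane → ℝ) : ∫ x in closure Ω, f x = ∫ x in Ω, f x :=
  setIntegral_congr_set (closure_ae_eq hT hΩ)

/-- The sum over the bands is bounded by the energy of the error on the bands and by terms of the
order of the error estimate. -/
lemma sum_bands_le (hT : IsTriangulation T Ω) (hΩ : IsOpen Ω) (hcomp : IsCompact (closure Ω))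
    (hU : U ∈ X T) {h : ℝ} (hh : ∀ s ∈ elements T, Metric.diam (body s) ≤ h) {CK : ℝ}
    (hCK : 0 ≤ CK) {NB : ℕ} {B : Fin NB → Band T}
    (hB : ∀ b b', b ≠ b' → Disjoint (B b).elems (B b').elems)
    (hK : ∀ b, ∀ i ∈ Finset.Icc 1 (B b).N, area ((B b).Kt i) ≤ CK * area ((B b).K i) ∧
      area ((B b).Kt i) ≤ CK * area ((B b).K (i - 1)))
    {κ : ℝ} (hL : ∀ b, (B b).L ≤
      κ * ∑ i ∈ Finset.Icc 1 (B b).N, |(B b).slope hU i - (B b).slope hU (i - 1)|) :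
    ∑ b, (B b).minOver (fun i => 1 / Real.sin (Real.pi - (B b).αt i) ^ 2) *
      (B b).minOver (fun i => area ((B b).Kt i)) * (B b).L ^ 2 / ((B b).N : ℝ) ≤
    24 * κ ^ 2 * (∫ x in ⋃ b, (B b).region, ‖gradient (fun x => uExact x - U x) x‖ ^ 2)
      + κ ^ 2 * (48 * CK * (∫ x in closure Ω, ‖gradient (fun x => uExact x - U x) x‖ ^ 2)
        + (96 + 192 * CK) * volume.real (closure Ω) * h ^ 2) := by
  have hint := integrableOn_normSq_gradient hT hΩ hU
  have hreg : ⋃ b, (B b).region ⊆ closure Ω :=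
    iUnion_subset fun b => (B b).region_subset_closure hT
  obtain ⟨f, hf⟩ : ∃ f : Plane → ℝ,
    f = fun x => 2 * ‖gradient (fun x => uExact x - U x) x‖ ^ 2 + 8 * h ^ 2 := ⟨_, rfl⟩
  have hf0 : ∀ x, 0 ≤ f x := fun x => by rw [hf]; positivity
  have hfΩ : IntegrableOn f (closure Ω) := by
    rw [hf]
    exact (hint.const_mul 2).add (integrableOn_const hcomp.measure_lt_top.ne)
  have hfS : ∀ S ⊆ closure Ω, ∫ x in S, f x ≤
      2 * (∫ x in S, ‖gradient (fun x => uExact x - U x) x‖ ^ 2)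
        + 8 * h ^ 2 * volume.real (closure Ω) := by
    intro S hS
    have hSfin : volume S ≠ ⊤ := ((measure_mono hS).trans_lt hcomp.measure_lt_top).ne
    rw [hf, integral_add ((hint.mono_set hS).const_mul 2) (integrableOn_const hSfin),
      integral_const_mul, setIntegral_const, smul_eq_mul, mul_comm (volume.real S)]
    gcongr
    exact hcomp.measure_lt_top.ne
  have hband : ∀ b, (B b).minOver (fun i => 1 / Real.sin (Real.pi - (B b).αt i) ^ 2) *
      (B b).minOver (fun i => area ((B b).Kt i)) * (B b).L ^ 2 / ((B b).N : ℝ) ≤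
      κ ^ 2 * (12 * ((∑ i ∈ Finset.Icc 1 (B b).N, ∫ x in body ((B b).Kt i), f x)
        + CK * (∑ i ∈ Finset.Icc 1 (B b).N, ∫ x in body ((B b).K i), f x)
        + CK * (∑ i ∈ Finset.Icc 1 (B b).N, ∫ x in body ((B b).K (i - 1)), f x))) := by
    intro b
    refine ((B b).minOver_mul_le hU (hL b)).trans (mul_le_mul_of_nonneg_left ?_ (sq_nonneg _))
    simp only [Finset.mul_sum, ← Finset.sum_add_distrib]
    refine Finset.sum_le_sum fun i hi => ?_
    exact (B b).weighted_jump_sq_le hT hΩ hU hh hCK hi (hK b i hi).1 (hK b i hi).2 hf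
  -- The elements `Kt` are integrated over the bands only. The two sums over `K` come with `CK` and
  -- are bounded over all of `closure Ω`, where the error estimate is available.
  have h1 := sum_bands_setIntegral_le hB (k := fun b => (B b).Kt)
    (fun b i hi => Or.inr ⟨i, hi, rfl⟩) (fun b => (B b).Kt_injOn) hf0 subset_rfl
    (hfΩ.mono_set hreg)
  have h2 := sum_bands_setIntegral_le hB (k := fun b => (B b).K)
    (fun b i hi => Or.inl ⟨i, (Finset.mem_Icc.1 hi).2, rfl⟩)
    (fun b => (B b).K_injOn.mono fun i hi => (Finset.mem_Icc.1 hi).2) hf0 hreg hfΩ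
  have h3 := sum_bands_setIntegral_le hB (k := fun b i => (B b).K (i - 1))
    (fun b i hi => Or.inl ⟨i - 1, by have := Finset.mem_Icc.1 hi; omega, rfl⟩)
    (fun b i hi j hj hij => by
      have hi' := Finset.mem_Icc.1 hi
      have hj' := Finset.mem_Icc.1 hj
      have := (B b).K_injOn (show i - 1 ≤ (B b).N by omega) (show j - 1 ≤ (B b).N by omega) hij
      omega) hf0 hreg hfΩ
  refine (Finset.sum_le_sum fun b _ => hband b).trans ?_
  rw [← Finset.mul_sum, ← Finset.mul_sum, Finset.sum_add_distrib, Finset.sum_add_distrib,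
    ← Finset.mul_sum, ← Finset.mul_sum]
  have hle : 12 * ((∑ b, ∑ i ∈ Finset.Icc 1 (B b).N, ∫ x in body ((B b).Kt i), f x)
      + CK * (∑ b, ∑ i ∈ Finset.Icc 1 (B b).N, ∫ x in body ((B b).K i), f x)
      + CK * (∑ b, ∑ i ∈ Finset.Icc 1 (B b).N, ∫ x in body ((B b).K (i - 1)), f x)) ≤
      12 * ((2 * (∫ x in ⋃ b, (B b).region, ‖gradient (fun x => uExact x - U x) x‖ ^ 2)
        + 8 * h ^ 2 * volume.real (closure Ω))
      + CK * (2 * (∫ x in closure Ω, ‖gradient (fun x => uExact x - U x) x‖ ^ 2)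
        + 8 * h ^ 2 * volume.real (closure Ω))
      + CK * (2 * (∫ x in closure Ω, ‖gradient (fun x => uExact x - U x) x‖ ^ 2)
        + 8 * h ^ 2 * volume.real (closure Ω))) := by
    gcongr
    · exact h1.trans (hfS _ hreg)
    · exact h2.trans (hfS _ subset_rfl)
    · exact h3.trans (hfS _ subset_rfl)
  refine (mul_le_mul_of_nonneg_left hle (sq_nonneg κ)).trans (le_of_eq ?_)
  ring

end FEMBand

/-! ### Choice of constants and conclusion -/

theorem theorem2p2
    (Ω : Set FEMBand.Plane) (hΩ : FEMBand.IsPolygonalDomain Ω)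
    (α : ℝ) (hα₀ : 0 ≤ α) (hα₁ : α ≤ 1) (Cu : ℝ) :
    -- constants depending only on the domain, the exponent and the constant of the error estimate
    ∃ CL > (0 : ℝ), ∃ C₁ > (0 : ℝ), ∀ CK Cα : ℝ, ∃ C₂ > (0 : ℝ),
      ∀ (T : Geometry.SimplicialComplex ℝ FEMBand.Plane) (h : ℝ) (U : FEMBand.Plane → ℝ),
        FEMBand.IsTriangulation T Ω → FEMBand.IsMeshSize T h → U ∈ FEMBand.X T →
        -- the error estimate
        FEMBand.h1Seminorm Ω (fun x => FEMBand.uExact x - U x) ≤ Cu * h ^ α →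
        ∀ (NB : ℕ) (B : Fin NB → FEMBand.Band T),
          -- the bands are disjoint families of elements
          (∀ b b', b ≠ b' → Disjoint (B b).elems (B b').elems) →
          (∀ b, ∀ i ∈ Finset.Icc 1 (B b).N,
            FEMBand.area ((B b).Kt i) ≤ CK * FEMBand.area ((B b).K i) ∧
            FEMBand.area ((B b).Kt i) ≤ CK * FEMBand.area ((B b).K (i - 1)) ∧
            Real.sin (Real.pi - (B b).α (i - 1)) ≤
              Cα * Real.sin (Real.pi - (B b).αt i)) →
          (∀ b, CL * h ^ (2 * α / 5) ≤ (B b).L) →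
          ∃ A₁ A₂ : ℝ,
            A₁ - A₂ ≤ FEMBand.h1Seminorm (⋃ b, (B b).region)
              (fun x => FEMBand.uExact x - U x) ∧
            C₁ * Real.sqrt (∑ b,
              (B b).minOver (fun i => 1 / Real.sin (Real.pi - (B b).αt i) ^ 2) *
              (B b).minOver (fun i => FEMBand.area ((B b).Kt i)) *
              (B b).L ^ 2 / ((B b).N : ℝ)) ≤ A₁ ∧
            |A₂| ≤ C₂ * h ^ α := by
  obtain ⟨F, r, D, hF, hr, hD, hcl, hball, hdist⟩ := hΩ.exists_constants
  have hcard : (0 : ℝ) < F.card := by exact_mod_cast hF.card_pos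
  obtain ⟨n, hn⟩ : ∃ n : ℝ, n = F.card := ⟨_, rfl⟩
  rw [← hn] at hcard
  obtain ⟨M, hM⟩ : ∃ M : ℝ, M = max 1 D := ⟨_, rfl⟩
  have hM1 : 1 ≤ M := hM ▸ le_max_left _ _
  have hMD : D ≤ M := hM ▸ le_max_right _ _
  -- `W` is the constant in the fourth-power bound once the error estimate is inserted. Taking `CL =
  -- 1 + W` makes `CL ^ 4 ≤ W` impossible.
  obtain ⟨W, hW⟩ : ∃ W : ℝ, W = (6 * n) ^ 4 * (864 * (D / r) * Cu ^ 2 * M) := ⟨_, rfl⟩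
  have hW0 : 0 ≤ W := by rw [hW]; positivity
  refine ⟨1 + W, by positivity, 1 / (60 * n), by positivity, fun CK Cα => ?_⟩
  obtain ⟨V, hV⟩ : ∃ V : ℝ, V = volume.real (closure Ω) := ⟨_, rfl⟩
  have hV0 : 0 ≤ V := hV ▸ measureReal_nonneg
  -- `CK` is arbitrary and may be negative, hence the absolute values.
  obtain ⟨Z, hZ⟩ : ∃ Z : ℝ, Z = 48 * |CK| * Cu ^ 2 + (96 + 192 * |CK|) * V * M ^ 2 := ⟨_, rfl⟩
  have hZ0 : 0 ≤ Z := by rw [hZ]; positivity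
  refine ⟨Real.sqrt Z + 1, by positivity, ?_⟩
  intro T h U hT hmesh hU herr NB B hB hBcond hBL
  have hh : ∀ s ∈ FEMBand.elements T, Metric.diam (FEMBand.body s) ≤ h := fun s hs =>
    hmesh.2 (mem_image_of_mem _ hs)
  obtain ⟨s₀, hs₀, hs₀h⟩ := hmesh.1
  have hh0 : 0 < h := by
    rw [← hs₀h]
    obtain ⟨x, hx, y, hy, hxy⟩ := Finset.one_lt_card.1 (show 1 < s₀.card by rw [hs₀.2]; norm_num)
    exact (dist_pos.2 hxy).trans_le (Metric.dist_le_diam_of_mem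
      (FEMBand.isCompact_body s₀).isBounded (FEMBand.mem_body_of_mem hx)
      (FEMBand.mem_body_of_mem hy))
  have hhM : h ≤ M := by
    rw [← hs₀h]
    refine (Metric.diam_le_of_forall_dist_le hD.le fun x hx y hy => ?_).trans hMD
    exact hdist x (FEMBand.body_subset_closure hT hs₀ hx) y (FEMBand.body_subset_closure hT hs₀ hy)
  have hpow : ∀ β : ℝ, 0 ≤ β → β ≤ 1 → h ^ β ≤ M := fun β hβ0 hβ1 =>
    (Real.rpow_le_rpow hh0.le hhM hβ0).trans
      ((Real.rpow_le_rpow_of_exponent_le hM1 hβ1).trans (Real.rpow_one M).le)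
  -- The variation of `∇u` inside an element costs order `h`, which is thus of the order of the
  -- error estimate.
  have hhα : h ≤ M * h ^ α := by
    calc h = h ^ (1 - α) * h ^ α := by
          rw [← Real.rpow_add hh0, sub_add_cancel, Real.rpow_one]
      _ ≤ M * h ^ α := by
          gcongr
          exact hpow _ (by linarith) (by linarith)
  have hα0 : 0 < h ^ α := Real.rpow_pos_of_pos hh0 α
  obtain ⟨E, hE⟩ : ∃ E, E = ∫ x in closure Ω,
    ‖gradient (fun x => FEMBand.uExact x - U x) x‖ ^ 2 := ⟨_, rfl⟩
  have hE0 : 0 ≤ E := hE ▸ integral_nonneg fun x => by positivity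
  have hEle : E ≤ Cu ^ 2 * (h ^ α) ^ 2 := by
    rw [FEMBand.h1Seminorm, ← FEMBand.setIntegral_closure_eq hT hΩ, ← hE] at herr
    have := pow_le_pow_left₀ (Real.sqrt_nonneg _) herr 2
    rwa [Real.sq_sqrt hE0, mul_pow] at this
  have hvar : ∀ b, (B b).L ≤ (12 * n) * ∑ i ∈ Finset.Icc 1 (B b).N,
      |(B b).slope hU i - (B b).slope hU (i - 1)| := by
    intro b
    rcases (B b).length_le_variation_or hT hΩ.isOpen hU hF hcl hr hball hD hdist with h1 | h1
    · rwa [← hn] at h1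
    · exfalso
      rw [← hn, ← hE, div_pow, div_le_iff₀ (by positivity)] at h1
      -- Four of the five factors match `L⁴`; the fifth is bounded by `M`.
      have hβ : (h ^ α) ^ 2 = (h ^ (2 * α / 5)) ^ 4 * h ^ (2 * α / 5) := by
        rw [← pow_succ, ← Real.rpow_natCast, ← Real.rpow_natCast, ← Real.rpow_mul hh0.le,
          ← Real.rpow_mul hh0.le]
        congr 1
        push_cast
        ring
      have hx0 : 0 < h ^ (2 * α / 5) := Real.rpow_pos_of_pos hh0 _
      have hxM := hpow (2 * α / 5) (by linarith) (by linarith)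
      have hLb := pow_le_pow_left₀ (by positivity) (hBL b) 4
      generalize h ^ (2 * α / 5) = x at *
      have h2 : ((1 + W) * x) ^ 4 ≤ W * x ^ 4 := by
        calc ((1 + W) * x) ^ 4 ≤ 864 * (D / r) * E * (6 * n) ^ 4 := hLb.trans h1
          _ ≤ 864 * (D / r) * (Cu ^ 2 * (x ^ 4 * M)) * (6 * n) ^ 4 := by
              gcongr
              refine hEle.trans ?_
              rw [hβ]
              gcongr
          _ = W * x ^ 4 := by rw [hW]; ring
      rw [mul_pow] at h2
      have h3 : (1 + W) ^ 4 ≤ W := le_of_mul_le_mul_right h2 (by positivity)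
      have h4 : (1 + W) ^ 1 ≤ (1 + W) ^ 4 := pow_le_pow_right₀ (by linarith) (by norm_num)
      linarith
  have hmain := FEMBand.sum_bands_le hT hΩ.isOpen hΩ.isCompact_closure hU hh (abs_nonneg CK) hB
    (fun b i hi => ⟨(hBcond b i hi).1.trans (mul_le_mul_of_nonneg_right (le_abs_self CK)
      measureReal_nonneg), (hBcond b i hi).2.1.trans (mul_le_mul_of_nonneg_right (le_abs_self CK)
      measureReal_nonneg)⟩) hvar
  rw [← hE, ← hV] at hmain
  obtain ⟨EB, hEB⟩ : ∃ EB, EB = ∫ x in ⋃ b, (B b).region,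
    ‖gradient (fun x => FEMBand.uExact x - U x) x‖ ^ 2 := ⟨_, rfl⟩
  have hEB0 : 0 ≤ EB := hEB ▸ integral_nonneg fun x => by positivity
  rw [← hEB] at hmain
  rw [FEMBand.h1Seminorm, ← hEB]
  generalize (∑ b, (B b).minOver (fun i => 1 / Real.sin (Real.pi - (B b).αt i) ^ 2) *
    (B b).minOver (fun i => FEMBand.area ((B b).Kt i)) * (B b).L ^ 2 / ((B b).N : ℝ)) = S at *
  have hrest : 48 * |CK| * E + (96 + 192 * |CK|) * V * h ^ 2 ≤ Z * (h ^ α) ^ 2 := by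
    have h2 : h ^ 2 ≤ M ^ 2 * (h ^ α) ^ 2 := by
      rw [← mul_pow]
      exact pow_le_pow_left₀ hh0.le hhα 2
    calc 48 * |CK| * E + (96 + 192 * |CK|) * V * h ^ 2
        ≤ 48 * |CK| * (Cu ^ 2 * (h ^ α) ^ 2)
          + (96 + 192 * |CK|) * V * (M ^ 2 * (h ^ α) ^ 2) := by gcongr
      _ = _ := by rw [hZ]; ring
  -- The number 60 suffices because `24 * 12² ≤ 60²`.
  have hS : S ≤ (60 * n) ^ 2 * (Real.sqrt EB + Real.sqrt Z * h ^ α) ^ 2 := by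
    have h1 : EB + Z * (h ^ α) ^ 2 ≤ (Real.sqrt EB + Real.sqrt Z * h ^ α) ^ 2 := by
      have e1 := Real.sq_sqrt hEB0
      have e2 := Real.sq_sqrt hZ0
      have e3 : 0 ≤ Real.sqrt EB * (Real.sqrt Z * h ^ α) := by positivity
      nlinarith
    have h2 : (12 * n) ^ 2 * (48 * |CK| * E + (96 + 192 * |CK|) * V * h ^ 2)
        ≤ (12 * n) ^ 2 * (Z * (h ^ α) ^ 2) := mul_le_mul_of_nonneg_left hrest (sq_nonneg _)
    have h3 : 0 ≤ n ^ 2 * EB := by positivity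
    have h4 : 0 ≤ n ^ 2 * (Z * (h ^ α) ^ 2) := by positivity
    have h5 := mul_le_mul_of_nonneg_left h1 (sq_nonneg (60 * n))
    linarith
  have hsqrt : 1 / (60 * n) * Real.sqrt S ≤ Real.sqrt EB + Real.sqrt Z * h ^ α := by
    rw [one_div, inv_mul_le_iff₀ (by positivity)]
    refine (Real.sqrt_le_left (by positivity)).2 ?_
    rwa [mul_pow]
  refine ⟨1 / (60 * n) * Real.sqrt S, Real.sqrt Z * h ^ α, by linarith, le_rfl, ?_⟩
  rw [abs_of_nonneg (by positivity)]
  nlinarith
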